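/- Let $\mathcal M$ and $\mathcal W$ be finite sets of men and women, and let $N=\min(|\mathcal M|,|\mathcal W|)$. Each person has a set of acceptable members of the opposite sex and a strictly ordered preference list of them (being single comes next, then the unacceptable ones). In a matching each person is single or matched with one person of the opposite sex. A matching is stable if nobody prefers being single to his or her situation, and no man and woman both strictly prefer each other to their situation. A stable pair is a man-woman pair which belongs to at least one stable matching. A person $p$ has popularity preferences if $p$ has a fixed (deterministic) set $A_p$ of acceptable partners, gives a positive popularity $\mathcal D_p(q)$ to each $q\in A_p$, and the preference list of $p$ is random, obtained by drawing the elements of $A_p$ one after the other without replacement (favourite first), each time with probability proportional to $\mathcal D_p$ among the elements not drawn yet. (The popularities need not sum to $1$.) In both of the following settings the expected number of stable pairs is at most $N(1+\ln N)$ (read as $0$ if $N=0$). (1) The preference lists of the men are arbitrary (deterministic). The women have popularity preferences, their lists are independent, and each man $m$ has an intrinsic popularity $\mathcal D(m)$ such that $\mathcal D_w(m)=\mathcal D(m)$ whenever woman $w$ finds man $m$ acceptable. (2) All men and women have popularity preferences, all lists are mutually independent, and $\mathcal D_m(w)=\mathcal D_w(m)$ whenever $m$ and $w$ are mutually acceptable.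 -/

import Mathlib

open MeasureTheory ProbabilityTheory

noncomputable section

namespace StableMarriage

/-- A preference list of a person over the members `α` of the opposite sex: a strictly ordered list
(favourite first) of the acceptable ones; the others are unacceptable. -/
def PrefList (α : Type*) : Type _ := {l : List α // l.Nodup}

/-- Preference lists are regarded as a discrete measurable space. -/
instance (α : Type*) : MeasurableSpace (PrefList α) := ⊤

section Preferences

variable {α : Type*} [DecidableEq α]

/-- The position of an outcome for a person with preference list `l`, where `some a` stands for being
matched with `a` and `none` for being single: first the acceptable partners in the order of the list,
then being single, then the unacceptable partners. -/
def PrefList.position (l : PrefList α) : Option α → ℕ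
  | some a => if a ∈ l.1 then l.1.idxOf a else l.1.length + 1
  | none => l.1.length

/-- `l.Prefers x y`: a person with preference list `l` strictly prefers outcome `x` to outcome `y`. -/
def PrefList.Prefers (l : PrefList α) (x y : Option α) : Prop :=
  l.position x < l.position y

end Preferences

/-- A matching between men `M` and women `W`: a self-inverse map on all persons, which sends each
person to a person of the opposite sex or to himself or herself (if single). -/
structure Matching (M W : Type*) where
  toFun : M ⊕ W → M ⊕ W
  involutive : Function.Involutive toFun
  man_or_self : ∀ m : M, toFun (Sum.inl m) = Sum.inl m ∨ ∃ w : W, toFun (Sum.inl m) = Sum.inr w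
  woman_or_self : ∀ w : W, toFun (Sum.inr w) = Sum.inr w ∨ ∃ m : M, toFun (Sum.inr w) = Sum.inl m

section Stability

variable {M W : Type*}

/-- The wife of `m`, or `none` if `m` is single. -/
def Matching.wife (μ : Matching M W) (m : M) : Option W := (μ.toFun (Sum.inl m)).getRight?

/-- The husband of `w`, or `none` if `w` is single. -/
def Matching.husband (μ : Matching M W) (w : W) : Option M := (μ.toFun (Sum.inr w)).getLeft?

variable [DecidableEq M] [DecidableEq W]

/-- A matching is stable when nobody would prefer to be single and there is no man-woman pair who both
prefer each other to their situation in the matching. -/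
structure Matching.IsStable (prefM : M → PrefList W) (prefW : W → PrefList M)
    (μ : Matching M W) : Prop where
  man_rational : ∀ m, ¬ (prefM m).Prefers none (μ.wife m)
  woman_rational : ∀ w, ¬ (prefW w).Prefers none (μ.husband w)
  no_blocking : ∀ m w,
    ¬ ((prefW w).Prefers (some m) (μ.husband w) ∧ (prefM m).Prefers (some w) (μ.wife m))

/-- `(m, w)` is a stable pair: it belongs to at least one stable matching. -/
def IsStablePair (prefM : M → PrefList W) (prefW : W → PrefList M) (m : M) (w : W) : Prop :=
  ∃ μ : Matching M W, μ.IsStable prefM prefW ∧ μ.wife m = some w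

/-- The number of stable pairs. -/
def numStablePairs (prefM : M → PrefList W) (prefW : W → PrefList M) : ℕ :=
  Set.ncard {p : M × W | IsStablePair prefM prefW p.1 p.2}

end Stability

section Popularity

variable {α : Type*} [DecidableEq α]

/-- The probability that drawing all elements of `A` successively without replacement, each time with
probability proportional to the weight `D` among the elements not drawn yet, produces exactly the
sequence `l` (in this order). -/
def drawProb (D : α → ℝ) : Finset α → List α → ℝ
  | A, [] => if A = ∅ then 1 else 0
  | A, a :: l => if a ∈ A then D a / (∑ b ∈ A, D b) * drawProb D (A.erase a) l else 0

/-- The random preference list `X` is drawn from the popularity preferences given by the set `A` of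
acceptable partners and the positive popularities `D a`, `a ∈ A`: favourite, second favourite, and so
on are drawn one after the other with probabilities proportional to the popularities. -/
structure HasPopularityPreferences {Ω : Type*} [MeasurableSpace Ω] (P : Measure Ω)
    (X : Ω → PrefList α) (A : Finset α) (D : α → ℝ) : Prop where
  measurable : Measurable X
  pos : ∀ a ∈ A, 0 < D a
  law : ∀ l : PrefList α, P.real {ω | X ω = l} = drawProb D A l.1

end Popularity

end StableMarriage

end

noncomputable section

namespace StableMarriage

set_option linter.unusedSectionVars false

/-! ### Expectations under successive draws without replacement -/

section DrawMean

variable {α : Type*} [DecidableEq α]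

/-! Fix a woman `w` and all lists except hers. Let `S` be the acceptable men who would propose to
her in deferred acceptance if she rejected everybody, and `R m ⊆ S` those who propose if she rejects
everybody but `m`. Neither depends on her own list. By `isStablePair_iff_suitors`, `m` is a stable
husband of `w` exactly when he is her favourite in `R m`, and the sets `R m` satisfy a chain
condition (`IsCompetition`).

The event that `m` is her worst stable husband depends only on her order within `R m`. Given this
event, a man `m'` outside `R m` is a stable husband with probability `D m' / D (R m')`. The sum of
these ratios is at most `log (D S / D (R m))`. An entropy bound turns this logarithm into `log N`
plus the expected log-popularity of her best stable husband minus that of her worst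
(`IsCompetition.drawMean_wins_le`); `N` appears because `m` and the men of `S \ R m` are
simultaneously matched in one fixed point.

Summed over the at most `N` women who have a stable husband, this gives `N (1 + log N)` plus the
expected sum of `logGain`. The best husband of `w` is `m` exactly when the worst wife of `m` is `w`,
and conversely. With intrinsic popularities the gains therefore cancel (`sum_logGain_eq_zero`). With
symmetric popularities the gain of the men is the opposite of that of the women
(`sum_logGain_swap`), and the two bounds are averaged. -/

instance [Fintype α] : Fintype (PrefList α) :=
  inferInstanceAs (Fintype {l : List α // l.Nodup})

lemma drawProb_nonneg {D : α → ℝ} {A : Finset α} (hD : ∀ a ∈ A, 0 < D a) (l : List α) :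
    0 ≤ drawProb D A l := by
  induction l generalizing A with
  | nil => rw [drawProb]; split_ifs <;> norm_num
  | cons a l ih =>
    rw [drawProb]
    split_ifs with h
    · refine mul_nonneg (div_nonneg (hD a h).le (Finset.sum_nonneg fun b hb => (hD b hb).le))
        (ih fun b hb => hD b (Finset.mem_of_mem_erase hb))
    · exact le_rfl

lemma mem_iff_of_drawProb_ne_zero {D : α → ℝ} {A : Finset α} {l : List α}
    (h : drawProb D A l ≠ 0) (a : α) : a ∈ l ↔ a ∈ A := by
  induction l generalizing A with
  | nil =>
    rw [drawProb] at h
    split_ifs at h with hA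
    · simp [hA]
    · exact absurd rfl h
  | cons b l ih =>
    rw [drawProb] at h
    split_ifs at h with hb
    · rw [List.mem_cons, ih (right_ne_zero_of_mul h), Finset.mem_erase]
      constructor
      · rintro (rfl | h)
        exacts [hb, h.2]
      · intro ha
        by_cases hab : a = b
        exacts [Or.inl hab, Or.inr ⟨hab, ha⟩]
    · exact absurd rfl h

variable [Fintype α]

/-- The expectation of `g l` for a list `l` drawn successively from `A` with popularities `D`. -/
def drawMean (D : α → ℝ) (A : Finset α) (g : List α → ℝ) : ℝ :=
  ∑ l : PrefList α, drawProb D A l.1 * g l.1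

lemma drawMean_empty (D : α → ℝ) (g : List α → ℝ) : drawMean D ∅ g = g [] := by
  refine (Finset.sum_eq_single (⟨[], List.nodup_nil⟩ : PrefList α) ?_ ?_).trans ?_
  · rintro ⟨l, hl⟩ - hne
    cases l with
    | nil => exact absurd rfl hne
    | cons a l => simp [drawProb]
  · exact fun h => absurd (Finset.mem_univ _) h
  · simp [drawProb]

lemma drawMean_step (D : α → ℝ) {A : Finset α} (hA : A.Nonempty) (g : List α → ℝ) :
    drawMean D A g =
      ∑ a ∈ A, D a / (∑ b ∈ A, D b) * drawMean D (A.erase a) (fun l => g (a :: l)) := by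
  simp only [drawMean, Finset.mul_sum]
  rw [← Finset.sum_product']
  symm
  -- A term whose tail repeats `a` has probability zero, so the bijection `(a, l) ↦ a :: l` only has
  -- to produce duplicate-free lists on the nonzero terms.
  have key : ∀ (a : α) (l : PrefList α), a ∈ A →
      D a / (∑ b ∈ A, D b) * (drawProb D (A.erase a) l.1 * g (a :: l.1)) ≠ 0 → a ∉ l.1 := by
    intro a l _ h hal
    have h1 := left_ne_zero_of_mul (right_ne_zero_of_mul h)
    exact Finset.notMem_erase a A ((mem_iff_of_drawProb_ne_zero h1 a).1 hal)
  refine Finset.sum_bij_ne_zero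
    (fun p hp h => (⟨p.1 :: p.2.1, List.nodup_cons.2
      ⟨key p.1 p.2 (Finset.mem_product.1 hp).1 h, p.2.2⟩⟩ : PrefList α)) ?_ ?_ ?_ ?_
  · intros; exact Finset.mem_univ _
  · rintro ⟨a, l⟩ h1 h2 ⟨b, l'⟩ h3 h4 heq
    have := congrArg Subtype.val heq
    simp only [List.cons.injEq] at this
    exact Prod.ext this.1 (Subtype.ext this.2)
  · rintro ⟨l, hl⟩ - h
    cases l with
    | nil =>
      simp [drawProb, hA.ne_empty] at h
    | cons a l =>
      have ha : a ∈ A := by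
        by_contra hc
        simp [drawProb, hc] at h
      refine ⟨(a, ⟨l, (List.nodup_cons.1 hl).2⟩),
        Finset.mem_product.2 ⟨ha, Finset.mem_univ _⟩, ?_, rfl⟩
      rw [drawProb, if_pos ha] at h
      rwa [mul_assoc] at h
  · rintro ⟨a, l⟩ h1 h2
    have ha := (Finset.mem_product.1 h1).1
    simp only at ha
    simp only [drawProb]
    rw [if_pos ha, mul_assoc]

/-- Draws outside `R` are merely skipped, and a draw conditioned to lie in `R` is still proportional
to `D`. The induction conditions on the first element drawn. -/
lemma drawMean_filter {D : α → ℝ} {A R : Finset α} (hD : ∀ a ∈ A, 0 < D a) (hR : R ⊆ A)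
    (g : List α → ℝ) :
    drawMean D A (fun l => g (l.filter (· ∈ R))) = drawMean D R g := by
  induction A using Finset.strongInduction generalizing R g with
  | H A ih =>
    rcases R.eq_empty_or_nonempty with rfl | hRn
    · rcases A.eq_empty_or_nonempty with rfl | hA
      · simp [drawMean_empty]
      · rw [drawMean_step D hA]
        have hpos : 0 < ∑ b ∈ A, D b := Finset.sum_pos hD hA
        have : ∀ a ∈ A, drawMean D (A.erase a)
            (fun l => g ((a :: l).filter (· ∈ (∅ : Finset α)))) = drawMean D ∅ g := by
          intro a ha
          simpa using ih (A.erase a) (Finset.erase_ssubset ha)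
            (fun b hb => hD b (Finset.mem_of_mem_erase hb)) (Finset.empty_subset _) g
        rw [Finset.sum_congr rfl fun a ha => by rw [this a ha], ← Finset.sum_mul,
          ← Finset.sum_div, div_self hpos.ne', one_mul]
    · have hA : A.Nonempty := hRn.mono hR
      have hpos : 0 < ∑ b ∈ A, D b := Finset.sum_pos hD hA
      have hposR : 0 < ∑ b ∈ R, D b := Finset.sum_pos (fun a ha => hD a (hR ha)) hRn
      have h1 : ∀ a ∈ A \ R, drawMean D (A.erase a)
          (fun l => g ((a :: l).filter (· ∈ R))) = drawMean D R g := by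
        intro a ha
        obtain ⟨haA, haR⟩ := Finset.mem_sdiff.1 ha
        simp only [List.filter_cons, haR, decide_false, Bool.false_eq_true, if_false]
        exact ih (A.erase a) (Finset.erase_ssubset haA)
            (fun b hb => hD b (Finset.mem_of_mem_erase hb))
            (fun b hb => Finset.mem_erase.2 ⟨fun h => haR (h ▸ hb), hR hb⟩) g
      have h2 : ∀ a ∈ R, drawMean D (A.erase a)
          (fun l => g ((a :: l).filter (· ∈ R))) =
            drawMean D (R.erase a) (fun l => g (a :: l)) := by
        intro a ha
        rw [← ih (A.erase a) (Finset.erase_ssubset (hR ha))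
            (fun b hb => hD b (Finset.mem_of_mem_erase hb))
            (Finset.erase_subset_erase a hR)]
        unfold drawMean
        refine Finset.sum_congr rfl fun l _ => ?_
        by_cases h0 : drawProb D (A.erase a) l.1 = 0
        · simp [h0]
        · congr 1
          simp only [List.filter_cons, ha, decide_true, if_true]
          congr 2
          -- The tail no longer contains `a`, so filtering it by `R` or by `R.erase a` is the same.
          refine List.filter_congr fun b hb => ?_
          have := Finset.mem_erase.1 ((mem_iff_of_drawProb_ne_zero h0 b).1 hb)
          simp [this.1]
      rw [drawMean_step D hA, ← Finset.sum_sdiff hR,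
        Finset.sum_congr (s₁ := A \ R) rfl fun a ha => by rw [h1 a ha],
        Finset.sum_congr (s₁ := R) rfl fun a ha => by rw [h2 a ha]]
      have h3 : ∑ a ∈ R, D a / (∑ b ∈ A, D b) * drawMean D (R.erase a) (fun l => g (a :: l)) =
          (∑ b ∈ R, D b) / (∑ b ∈ A, D b) * drawMean D R g := by
        rw [drawMean_step D hRn, Finset.mul_sum]
        refine Finset.sum_congr rfl fun a _ => ?_
        field_simp
      rw [h3, ← Finset.sum_mul, ← add_mul, ← Finset.sum_div, ← add_div,
        Finset.sum_sdiff hR, div_self hpos.ne', one_mul]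

lemma drawMean_const {D : α → ℝ} {A : Finset α} (hD : ∀ a ∈ A, 0 < D a) (c : ℝ) :
    drawMean D A (fun _ => c) = c := by
  rw [drawMean_filter hD (Finset.empty_subset A) (fun _ => c), drawMean_empty]

lemma drawMean_add (D : α → ℝ) (A : Finset α) (f g : List α → ℝ) :
    drawMean D A (fun l => f l + g l) = drawMean D A f + drawMean D A g := by
  simp only [drawMean, mul_add, Finset.sum_add_distrib]

lemma drawMean_sub (D : α → ℝ) (A : Finset α) (f g : List α → ℝ) :
    drawMean D A (fun l => f l - g l) = drawMean D A f - drawMean D A g := by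
  simp only [drawMean, mul_sub, Finset.sum_sub_distrib]

lemma drawMean_mul_left (D : α → ℝ) (A : Finset α) (c : ℝ) (g : List α → ℝ) :
    drawMean D A (fun l => c * g l) = c * drawMean D A g := by
  simp only [drawMean, Finset.mul_sum]
  exact Finset.sum_congr rfl fun l _ => by ring

lemma drawMean_sum {ι : Type*} (D : α → ℝ) (A : Finset α) (s : Finset ι) (g : ι → List α → ℝ) :
    drawMean D A (fun l => ∑ i ∈ s, g i l) = ∑ i ∈ s, drawMean D A (g i) := by
  simp only [drawMean, Finset.mul_sum]
  exact Finset.sum_comm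

lemma drawMean_congr {D : α → ℝ} {A : Finset α} {f g : List α → ℝ}
    (h : ∀ l : List α, l.Nodup → (∀ a, a ∈ l ↔ a ∈ A) → f l = g l) :
    drawMean D A f = drawMean D A g := by
  refine Finset.sum_congr rfl fun l _ => ?_
  by_cases h0 : drawProb D A l.1 = 0
  · simp [h0]
  · rw [h l.1 l.2 (mem_iff_of_drawProb_ne_zero h0)]

/-- The favourite in a set `R'` is independent of the order within a smaller set `R` not
containing it. -/
lemma drawMean_filter_mul_head {D : α → ℝ} {A R R' : Finset α} (hD : ∀ a ∈ A, 0 < D a)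
    (hR' : R' ⊆ A) (hR : R ⊆ R') {m : α} (hm : m ∈ R') (hmR : m ∉ R) (g : List α → ℝ) :
    drawMean D A (fun l => g (l.filter (· ∈ R)) *
        (if (l.filter (· ∈ R')).head? = some m then 1 else 0)) =
      drawMean D A (fun l => g (l.filter (· ∈ R))) * (D m / ∑ b ∈ R', D b) := by
  have hff : ∀ l : List α, (l.filter (· ∈ R')).filter (· ∈ R) = l.filter (· ∈ R) := by
    intro l
    rw [List.filter_filter]
    refine List.filter_congr fun b _ => ?_
    by_cases hb : b ∈ R
    · simp [hb, hR hb]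
    · simp [hb]
  have h1 := drawMean_filter hD hR' (fun l => g (l.filter (· ∈ R)) *
        (if l.head? = some m then 1 else 0))
  simp only [hff] at h1
  -- The left side is now a draw from `R'`. Only the first draw `m` contributes, and what remains is
  -- drawn from `R'.erase m`, which still contains `R`.
  rw [h1, drawMean_filter hD (hR.trans hR') g, drawMean_step D ⟨m, hm⟩,
    Finset.sum_eq_single m]
  · have hD' : ∀ a ∈ R'.erase m, 0 < D a := fun a ha => hD a (hR' (Finset.mem_of_mem_erase ha))
    have hRm : R ⊆ R'.erase m := fun b hb =>
      Finset.mem_erase.2 ⟨fun h => hmR (h ▸ hb), hR hb⟩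
    simp only [List.head?_cons, if_true, mul_one, List.filter_cons, hmR, decide_false,
      Bool.false_eq_true, if_false]
    rw [drawMean_filter hD' hRm, mul_comm]
  · intro b _ hb
    simp [drawMean, hb]
  · exact fun h => absurd hm h

end DrawMean

/-! ### Counting winners of a competition in a random order -/

section Records

variable {α : Type*}

/-- The entropy of a distribution on at most `n` points is at most `log n`. -/
lemma log_div_le_log_add_sum {D : α → ℝ} {C : Finset α} {b : ℝ} {n : ℕ} (hb : 0 < b)
    (hD : ∀ c ∈ C, 0 < D c) (hn : 1 + C.card ≤ n) :
    Real.log (b + ∑ c ∈ C, D c) - Real.log b ≤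
      Real.log n + ∑ c ∈ C, D c / (b + ∑ c ∈ C, D c) * (Real.log (D c) - Real.log b) := by
  set T := b + ∑ c ∈ C, D c with hT
  have hTpos : 0 < T := add_pos_of_pos_of_nonneg hb (Finset.sum_nonneg fun c hc => (hD c hc).le)
  have hn0 : (0 : ℝ) < n := by exact_mod_cast (by omega : 0 < n)
  -- Gibbs' inequality against the uniform weight `1 / n`, term by term: `log t ≤ t - 1` at `t = T /
  -- (n x)`.
  have key : ∀ x : ℝ, 0 < x →
      x / T * (Real.log T - Real.log n - Real.log x) ≤ 1 / n - x / T := by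
    intro x hx
    have h1 := Real.log_le_sub_one_of_pos (show 0 < T / (n * x) by positivity)
    rw [Real.log_div hTpos.ne' (by positivity), Real.log_mul hn0.ne' hx.ne'] at h1
    calc x / T * (Real.log T - Real.log n - Real.log x)
        ≤ x / T * (T / (n * x) - 1) :=
          mul_le_mul_of_nonneg_left (by linarith) (by positivity)
      _ = 1 / n - x / T := by field_simp
  have h2 := add_le_add (key b hb) (Finset.sum_le_sum fun c hc => key (D c) (hD c hc))
  rw [Finset.sum_sub_distrib, Finset.sum_const, nsmul_eq_mul, ← Finset.sum_div] at h2
  have hsum : b / T + (∑ c ∈ C, D c) / T = 1 := by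
    rw [← add_div, ← hT, div_self hTpos.ne']
  have hcard : (1 : ℝ) / n + C.card * (1 / n) ≤ 1 := by
    have : (1 + C.card : ℝ) ≤ n := by exact_mod_cast hn
    rw [← one_add_mul, mul_one_div, div_le_one hn0]
    exact this
  have h3 : ∑ c ∈ C, D c / T * (Real.log T - Real.log n - Real.log (D c)) =
      (∑ c ∈ C, D c) / T * (Real.log T - Real.log n - Real.log b) -
        ∑ c ∈ C, D c / T * (Real.log (D c) - Real.log b) := by
    rw [Finset.sum_div, Finset.sum_mul, ← Finset.sum_sub_distrib]
    exact Finset.sum_congr rfl fun c _ => by ring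
  rw [h3] at h2
  have h4 : b / T * (Real.log T - Real.log n - Real.log b) +
      (∑ c ∈ C, D c) / T * (Real.log T - Real.log n - Real.log b) =
      Real.log T - Real.log n - Real.log b := by
    rw [← add_mul, hsum, one_mul]
  linarith

/-- A sum of ratios of increments to partial sums is bounded by a logarithm. -/
lemma sum_div_le_log_sub_log {D r : α → ℝ} {C : Finset α} {b : ℝ} (hb : 0 < b)
    (hD : ∀ c ∈ C, 0 < D c)
    (hr : ∀ C' ⊆ C, C'.Nonempty → ∃ c ∈ C', b + ∑ a ∈ C', D a ≤ r c) :
    ∑ c ∈ C, D c / r c ≤ Real.log (b + ∑ c ∈ C, D c) - Real.log b := by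
  classical
  induction C using Finset.strongInduction with
  | H C ih =>
    rcases C.eq_empty_or_nonempty with rfl | hC
    · simp
    -- Removing the element whose denominator dominates the whole sum replaces ordering `C`. Each
    -- removal costs at most the matching increment of the logarithm, by `1 - 1 / t ≤ log t`.
    · obtain ⟨c, hc, hrc⟩ := hr C subset_rfl hC
      have ih' := ih (C.erase c) (Finset.erase_ssubset hc)
        (fun a ha => hD a (Finset.mem_of_mem_erase ha))
        (fun C' hC' => hr C' (hC'.trans (Finset.erase_subset c C)))
      rw [← Finset.add_sum_erase C (fun c => D c / r c) hc]
      have hs := Finset.add_sum_erase C D hc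
      have h0 : 0 < b + ∑ a ∈ C.erase c, D a := add_pos_of_pos_of_nonneg hb
        (Finset.sum_nonneg fun a ha => (hD a (Finset.mem_of_mem_erase ha)).le)
      have hDc := hD c hc
      set x := b + ∑ a ∈ C.erase c, D a with hx
      have hT : b + ∑ a ∈ C, D a = D c + x := by rw [← hs]; ring
      rw [hT] at hrc ⊢
      have h1 : D c / r c ≤ D c / (D c + x) := by gcongr
      have h2 := Real.one_sub_inv_le_log_of_pos (show 0 < (D c + x) / x by positivity)
      rw [Real.log_div (by positivity) h0.ne'] at h2
      have h3 : 1 - ((D c + x) / x)⁻¹ = D c / (D c + x) := by field_simp; ring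
      linarith

variable [DecidableEq α]

lemma idxOf_injective_of_not_lt {l : List α} {a b : α} (ha : a ∈ l)
    (h1 : ¬ l.idxOf a < l.idxOf b) (h2 : ¬ l.idxOf b < l.idxOf a) : a = b :=
  (List.idxOf_inj ha).1 (le_antisymm (not_lt.1 h2) (not_lt.1 h1))

/-- An element absent from `l` has `idxOf` equal to the length of `l`, so members of `R` missing
from the list impose no condition. -/
lemma head?_filter_mem_eq_some_iff {l : List α} {R : Finset α} {m : α} :
    (l.filter (· ∈ R)).head? = some m ↔
      m ∈ l ∧ m ∈ R ∧ ∀ a ∈ R, ¬ l.idxOf a < l.idxOf m := by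
  induction l with
  | nil => simp
  | cons b l ih =>
    rw [List.filter_cons]
    by_cases hb : b ∈ R
    · simp only [hb, decide_true, if_true, List.head?_cons, Option.some.injEq]
      constructor
      · rintro rfl
        simp [hb]
      · rintro ⟨hm, hmR, h⟩
        by_contra hne
        refine h b hb ?_
        rw [List.idxOf_cons_self, List.idxOf_cons_ne _ hne]
        omega
    · simp only [hb, decide_false, Bool.false_eq_true, if_false, ih, List.mem_cons]
      have hne : ∀ a ∈ R, b ≠ a := fun a ha h => hb (h ▸ ha)
      constructor
      · rintro ⟨h1, h2, h3⟩
        refine ⟨Or.inr h1, h2, fun a ha => ?_⟩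
        rw [List.idxOf_cons_ne _ (hne a ha), List.idxOf_cons_ne _ (hne m h2)]
        have := h3 a ha
        omega
      · rintro ⟨h1, h2, h3⟩
        refine ⟨h1.resolve_left fun h => hne m h2 h.symm, h2, fun a ha => ?_⟩
        have := h3 a ha
        rw [List.idxOf_cons_ne _ (hne a ha), List.idxOf_cons_ne _ (hne m h2)] at this
        omega

lemma exists_head?_filter_mem {l : List α} {R : Finset α} (hR : R.Nonempty)
    (hl : ∀ a ∈ R, a ∈ l) : ∃ m ∈ R, (l.filter (· ∈ R)).head? = some m := by
  obtain ⟨m, hm, h⟩ := R.exists_min_image (fun a => l.idxOf a) hR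
  exact ⟨m, hm, head?_filter_mem_eq_some_iff.2 ⟨hl m hm, hm, fun a ha => not_lt.2 (h a ha)⟩⟩

/-- `m` is the most preferred element of `T` for a person with list `l`. -/
def IsBest (l : List α) (T : α → Prop) (m : α) : Prop :=
  T m ∧ ∀ m', T m' → ¬ l.idxOf m' < l.idxOf m

/-- `m` is the least preferred element of `T` for a person with list `l`. -/
def IsWorst (l : List α) (T : α → Prop) (m : α) : Prop :=
  T m ∧ ∀ m', T m' → ¬ l.idxOf m < l.idxOf m'

/-- The family of sets `R m`, `m ∈ S`, where `R m` are the competitors of `m`. -/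
structure IsCompetition (S : Finset α) (R : α → Finset α) : Prop where
  self_mem : ∀ m ∈ S, m ∈ R m
  subset : ∀ m ∈ S, R m ⊆ S
  chain : ∀ m ∈ S, ∀ m' ∈ S, m' ∉ R m → R m ⊆ R m'

/-- `m` beats all its competitors. -/
def Wins (S : Finset α) (R : α → Finset α) (l : List α) (m : α) : Prop :=
  m ∈ S ∧ (l.filter (· ∈ R m)).head? = some m

/-- `m` beats all its competitors, and no competitor of `m` with fewer competitors does. -/
def WinsFirst (R : α → Finset α) (m : α) (l : List α) : Prop :=
  (l.filter (· ∈ R m)).head? = some m ∧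
    ∀ m' ∈ R m, m' ≠ m → R m' ⊆ R m → (l.filter (· ∈ R m')).head? ≠ some m'

/-- Only sets `R m' ⊆ R m` occur in the event, so it depends only on the order within `R m`. This is
what lets `drawMean_filter_mul_head` apply. -/
lemma winsFirst_filter {R : α → Finset α} {m : α} {l : List α} :
    WinsFirst R m (l.filter (· ∈ R m)) ↔ WinsFirst R m l := by
  have h : ∀ m', R m' ⊆ R m →
      (l.filter (· ∈ R m)).filter (· ∈ R m') = l.filter (· ∈ R m') := by
    intro m' hm'
    rw [List.filter_filter]
    refine List.filter_congr fun b _ => ?_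
    by_cases hb : b ∈ R m'
    · simp [hb, hm' hb]
    · simp [hb]
  unfold WinsFirst
  rw [h m subset_rfl]
  refine and_congr_right fun _ => forall_congr' fun m' => forall_congr' fun _ =>
    forall_congr' fun _ => forall_congr' fun hm' => ?_
  rw [h m' hm']

section Competition

variable {S : Finset α} {R : α → Finset α} {l : List α}

/-- The winner `m` beats all its competitors, so a different winner among them would be ranked below
the worst one. -/
lemma eq_of_isWorst_of_mem {m m' : α} (hm : IsWorst l (Wins S R l) m) (hm' : Wins S R l m')
    (h : m' ∈ R m) : m' = m := by
  obtain ⟨h1, -, h3⟩ := head?_filter_mem_eq_some_iff.1 hm.1.2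
  exact (idxOf_injective_of_not_lt h1 (hm.2 m' hm') (h3 m' h)).symm

/-- If a winner `m'` is ranked below `m`, then `m` is not a competitor of `m'`, so the chain
condition gives `R m' ⊆ R m`, which `WinsFirst` excludes. -/
lemma IsCompetition.isWorst_iff (hR : IsCompetition S R) {m : α} (hm : m ∈ S) :
    IsWorst l (Wins S R l) m ↔ WinsFirst R m l := by
  constructor
  · intro h
    exact ⟨h.1.2, fun m' hm' hne _ h' =>
      hne (eq_of_isWorst_of_mem h ⟨hR.subset m hm hm', h'⟩ hm')⟩
  · rintro ⟨h1, h2⟩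
    refine ⟨⟨hm, h1⟩, fun m' hm' hlt => ?_⟩
    have h3 : m ∉ R m' := fun h => (head?_filter_mem_eq_some_iff.1 hm'.2).2.2 m h hlt
    have h4 := hR.chain m' hm'.1 m hm h3
    exact h2 m' (h4 (hR.self_mem m' hm'.1)) (fun h => by simp [h] at hlt) h4 hm'.2

lemma IsCompetition.wins_of_head (hR : IsCompetition S R) {m : α}
    (h : (l.filter (· ∈ S)).head? = some m) : Wins S R l m := by
  obtain ⟨h1, h2, h3⟩ := head?_filter_mem_eq_some_iff.1 h
  exact ⟨h2, head?_filter_mem_eq_some_iff.2 ⟨h1, hR.self_mem m h2,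
    fun a ha => h3 a (hR.subset m h2 ha)⟩⟩

lemma IsCompetition.isBest_iff (hR : IsCompetition S R) (hl : ∀ a ∈ S, a ∈ l) {m : α} :
    IsBest l (Wins S R l) m ↔ (l.filter (· ∈ S)).head? = some m := by
  constructor
  · intro h
    obtain ⟨m', hm', h'⟩ := exists_head?_filter_mem ⟨m, h.1.1⟩ hl
    have h1 := h.2 m' (hR.wins_of_head h')
    have h2 := (head?_filter_mem_eq_some_iff.1 h').2.2 m h.1.1
    rwa [idxOf_injective_of_not_lt (hl m' hm') h1 h2] at h'
  · intro h
    exact ⟨hR.wins_of_head h, fun m' hm' => (head?_filter_mem_eq_some_iff.1 h).2.2 m' hm'.1⟩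

lemma IsCompetition.exists_isWorst (hR : IsCompetition S R) (hS : S.Nonempty)
    (hl : ∀ a ∈ S, a ∈ l) : ∃ m, IsWorst l (Wins S R l) m := by
  classical
  obtain ⟨m, hm, h⟩ := exists_head?_filter_mem hS hl
  obtain ⟨m', hm', h'⟩ := (S.filter (Wins S R l)).exists_max_image (fun a => l.idxOf a)
    ⟨m, Finset.mem_filter.2 ⟨hm, hR.wins_of_head h⟩⟩
  exact ⟨m', (Finset.mem_filter.1 hm').2,
    fun a ha => not_lt.2 (h' a (Finset.mem_filter.2 ⟨ha.1, ha⟩))⟩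

lemma isWorst_unique {T : α → Prop} (hT : ∀ a, T a → a ∈ l) {m m' : α} (hm : IsWorst l T m)
    (hm' : IsWorst l T m') : m = m' :=
  idxOf_injective_of_not_lt (hT m hm.1) (hm.2 m' hm'.1) (hm'.2 m hm.1)

lemma isBest_unique {T : α → Prop} (hT : ∀ a, T a → a ∈ l) {m m' : α} (hm : IsBest l T m)
    (hm' : IsBest l T m') : m = m' :=
  idxOf_injective_of_not_lt (hT m hm.1) (hm'.2 m hm.1) (hm.2 m' hm'.1)

lemma Wins.mem {m : α} (h : Wins S R l m) : m ∈ l := (head?_filter_mem_eq_some_iff.1 h.2).1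

end Competition

-- Only the worst winner `m` contributes to the right side. It is the only winner in `R m`, and the
-- inner sum counts the winners outside `R m`.
open Classical in
lemma IsCompetition.sum_wins {S : Finset α} {R : α → Finset α} {l : List α}
    (hR : IsCompetition S R) (hS : S.Nonempty) (hl : ∀ a ∈ S, a ∈ l) :
    ∑ m ∈ S, (if Wins S R l m then (1 : ℝ) else 0) =
      ∑ m ∈ S, ((if WinsFirst R m l then (1 : ℝ) else 0) +
        ∑ m' ∈ S \ R m, (if WinsFirst R m l then (1 : ℝ) else 0) *
          (if (l.filter (· ∈ R m')).head? = some m' then 1 else 0)) := by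
  obtain ⟨m, hm⟩ := hR.exists_isWorst hS hl
  have hmS := hm.1.1
  rw [Finset.sum_eq_single m (s := S) (f := fun m => (if WinsFirst R m l then (1 : ℝ) else 0) + _)]
  · rw [if_pos ((hR.isWorst_iff hmS).1 hm), ← Finset.sum_sdiff (hR.subset m hmS),
      add_comm, Finset.sum_eq_single m (s := R m), if_pos hm.1]
    · congr 1
      refine Finset.sum_congr rfl fun m' hm' => ?_
      simp only [one_mul, Wins, (Finset.mem_sdiff.1 hm').1, true_and]
    · intro m' hm' hne
      exact if_neg fun h => hne (eq_of_isWorst_of_mem hm h hm')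
    · exact fun h => absurd (hR.self_mem m hmS) h
  · intro m' hm' hne
    have : ¬ WinsFirst R m' l := fun h =>
      hne (isWorst_unique (fun a ha => ha.mem) ((hR.isWorst_iff hm').2 h) hm)
    simp [this]
  · exact fun h => absurd hmS h

open Classical in
/-- The expected number of winners is bounded in terms of the expected popularities of the
best and of the worst winner. -/
lemma IsCompetition.drawMean_wins_le [Fintype α] {A S : Finset α} {R : α → Finset α} {D : α → ℝ}
    {n : ℕ} (hR : IsCompetition S R) (hD : ∀ a ∈ A, 0 < D a) (hSA : S ⊆ A) (hS : S.Nonempty)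
    (hn : ∀ m ∈ S, 1 + (S \ R m).card ≤ n) :
    drawMean D A (fun l => ∑ m ∈ S, if Wins S R l m then (1 : ℝ) else 0) ≤
      1 + Real.log n +
        drawMean D A (fun l => ∑ m ∈ S, if (l.filter (· ∈ S)).head? = some m
          then Real.log (D m) else 0) -
        drawMean D A (fun l => ∑ m ∈ S, if WinsFirst R m l then Real.log (D m) else 0) := by
  -- `p m` is the probability that `m` is the worst winner.
  set p : α → ℝ := fun m => drawMean D A (fun l => if WinsFirst R m l then 1 else 0) with hp
  have hp0 : ∀ m ∈ S, 0 ≤ p m := fun m _ => Finset.sum_nonneg fun l _ =>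
    mul_nonneg (drawProb_nonneg hD _) (by dsimp only; split_ifs <;> norm_num)
  have hRA : ∀ m ∈ S, R m ⊆ A := fun m hm => (hR.subset m hm).trans hSA
  have hDR : ∀ m ∈ S, 0 < ∑ a ∈ R m, D a := fun m hm =>
    Finset.sum_pos (fun a ha => hD a (hRA m hm ha)) ⟨m, hR.self_mem m hm⟩
  have hind : ∀ m ∈ S, ∀ m' ∈ S \ R m, ∀ R' ⊆ A, R m ⊆ R' → m' ∈ R' →
      drawMean D A (fun l => (if WinsFirst R m l then (1 : ℝ) else 0) *
          (if (l.filter (· ∈ R')).head? = some m' then 1 else 0)) =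
        p m * (D m' / ∑ b ∈ R', D b) := by
    intro m hm m' hm' R' hR' hRR' hm'R'
    have := drawMean_filter_mul_head hD hR' hRR' hm'R' (Finset.mem_sdiff.1 hm').2
      (fun l => if WinsFirst R m l then (1 : ℝ) else 0)
    simpa only [winsFirst_filter] using this
  have hsum1 : ∑ m ∈ S, p m = 1 := by
    rw [hp, ← drawMean_sum]
    refine Eq.trans ?_ (drawMean_const hD 1)
    refine drawMean_congr fun l _ hl => ?_
    have hlS : ∀ a ∈ S, a ∈ l := fun a ha => (hl a).2 (hSA ha)
    obtain ⟨m, hm⟩ := hR.exists_isWorst hS hlS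
    rw [Finset.sum_eq_single m, if_pos ((hR.isWorst_iff hm.1.1).1 hm)]
    · intro m' hm' hne
      exact if_neg fun h => hne
        (isWorst_unique (fun a ha => ha.mem) ((hR.isWorst_iff hm').2 h) hm)
    · exact fun h => absurd hm.1.1 h
  have hcount : drawMean D A (fun l => ∑ m ∈ S, if Wins S R l m then (1 : ℝ) else 0) =
      ∑ m ∈ S, p m * (1 + ∑ m' ∈ S \ R m, D m' / ∑ b ∈ R m', D b) := by
    rw [drawMean_congr fun l _ hl => hR.sum_wins hS fun a ha => (hl a).2 (hSA ha),
      drawMean_sum]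
    refine Finset.sum_congr rfl fun m hm => ?_
    rw [drawMean_add, drawMean_sum, mul_add, mul_one, Finset.mul_sum]
    congr 1
    refine Finset.sum_congr rfl fun m' hm' => ?_
    obtain ⟨h1, h2⟩ := Finset.mem_sdiff.1 hm'
    exact hind m hm m' hm' _ (hRA m' h1) (hR.chain m hm m' h1 h2) (hR.self_mem m' h1)
  -- Given that `m` is the worst winner, the best one is `m' ∉ R m` with probability `D m' / D S`.
  -- If the best one lies in `R m` it is `m` itself and the difference vanishes.
  have hdiff : drawMean D A (fun l => ∑ m ∈ S, if (l.filter (· ∈ S)).head? = some m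
          then Real.log (D m) else 0) -
        drawMean D A (fun l => ∑ m ∈ S, if WinsFirst R m l then Real.log (D m) else 0) =
      ∑ m ∈ S, p m * ∑ m' ∈ S \ R m,
        D m' / (∑ b ∈ S, D b) * (Real.log (D m') - Real.log (D m)) := by
    rw [← drawMean_sub]
    have : ∀ m ∈ S, p m * ∑ m' ∈ S \ R m,
        D m' / (∑ b ∈ S, D b) * (Real.log (D m') - Real.log (D m)) =
        drawMean D A (fun l => ∑ m' ∈ S \ R m, (Real.log (D m') - Real.log (D m)) *
          ((if WinsFirst R m l then (1 : ℝ) else 0) *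
          (if (l.filter (· ∈ S)).head? = some m' then 1 else 0))) := by
      intro m hm
      rw [drawMean_sum, Finset.mul_sum]
      refine Finset.sum_congr rfl fun m' hm' => ?_
      rw [drawMean_mul_left, hind m hm m' hm' S hSA (hR.subset m hm) (Finset.mem_sdiff.1 hm').1]
      ring
    rw [Finset.sum_congr rfl this, ← drawMean_sum]
    refine drawMean_congr fun l _ hl => ?_
    have hlS : ∀ a ∈ S, a ∈ l := fun a ha => (hl a).2 (hSA ha)
    obtain ⟨m, hm⟩ := hR.exists_isWorst hS hlS
    obtain ⟨b, hb, hbest⟩ := exists_head?_filter_mem hS hlS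
    have hmS := hm.1.1
    have hw : ∀ m' ∈ S, m' ≠ m → ¬ WinsFirst R m' l := fun m' hm' hne h => hne
        (isWorst_unique (fun a ha => ha.mem) ((hR.isWorst_iff hm').2 h) hm)
    have hhead : ∀ m', (l.filter (· ∈ S)).head? = some m' ↔ b = m' := by
      intro m'
      rw [hbest, Option.some.injEq]
    rw [Finset.sum_eq_single m (s := S)
        (f := fun m => if WinsFirst R m l then Real.log (D m) else 0)
        (fun m' hm' hne => if_neg (hw m' hm' hne)) (fun h => absurd hmS h),
      Finset.sum_eq_single m (s := S) (f := fun m => ∑ m' ∈ S \ R m, _)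
        (fun m' hm' hne => Finset.sum_eq_zero fun x _ => by simp [hw m' hm' hne])
        (fun h => absurd hmS h)]
    simp only [hhead, Finset.sum_ite_eq, hb, if_true, if_pos ((hR.isWorst_iff hmS).1 hm),
      mul_ite, mul_one, mul_zero, Finset.mem_sdiff, true_and]
    split_ifs with hbR
    · rw [eq_of_isWorst_of_mem hm (hR.wins_of_head hbest) hbR, sub_self]
    · rfl
  rw [add_sub_assoc, hdiff, hcount]
  have hbound : ∀ m ∈ S, 1 + ∑ m' ∈ S \ R m, D m' / ∑ b ∈ R m', D b ≤
      1 + Real.log n + ∑ m' ∈ S \ R m,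
        D m' / (∑ b ∈ S, D b) * (Real.log (D m') - Real.log (D m)) := by
    intro m hm
    have hDC : ∀ c ∈ S \ R m, 0 < D c := fun c hc => hD c (hSA (Finset.mem_sdiff.1 hc).1)
    have hT : ∑ a ∈ R m, D a + ∑ a ∈ S \ R m, D a = ∑ a ∈ S, D a := by
      rw [add_comm, Finset.sum_sdiff (hR.subset m hm)]
    have h1 := sum_div_le_log_sub_log (r := fun m' => ∑ b ∈ R m', D b) (hDR m hm) hDC (by
      intro C' hC' hne
      -- An element `c` with the most competitors competes with all of `C'`: if `a ∉ R c`, the chain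
      -- condition makes `R a` strictly larger than `R c`.
      obtain ⟨c, hc, hmax⟩ := C'.exists_max_image (fun c => (R c).card) hne
      refine ⟨c, hc, ?_⟩
      have hcS := Finset.mem_sdiff.1 (hC' hc)
      have hdisj : Disjoint (R m) C' := Finset.disjoint_left.2 fun a ha ha' =>
        (Finset.mem_sdiff.1 (hC' ha')).2 ha
      rw [← Finset.sum_union hdisj]
      refine Finset.sum_le_sum_of_subset_of_nonneg (Finset.union_subset
        (hR.chain m hm c hcS.1 hcS.2) fun a ha => ?_) fun a ha _ => (hD a (hRA c hcS.1 ha)).le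
      by_contra hac
      have haS := (Finset.mem_sdiff.1 (hC' ha)).1
      have hss : R c ⊂ R a := (Finset.ssubset_iff_of_subset (hR.chain c hcS.1 a haS hac)).2
        ⟨a, hR.self_mem a haS, hac⟩
      exact absurd (hmax a ha) (not_le.2 (Finset.card_lt_card hss)))
    have h2 := log_div_le_log_add_sum (hDR m hm) hDC (hn m hm)
    rw [hT] at h1 h2
    have h3 : Real.log (D m) ≤ Real.log (∑ a ∈ R m, D a) :=
      Real.log_le_log (hD m (hSA hm)) (Finset.single_le_sum
        (fun a ha => (hD a (hRA m hm ha)).le) (hR.self_mem m hm))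
    have h4 : ∑ m' ∈ S \ R m, D m' / (∑ b ∈ S, D b) *
          (Real.log (D m') - Real.log (∑ a ∈ R m, D a)) ≤
        ∑ m' ∈ S \ R m, D m' / (∑ b ∈ S, D b) * (Real.log (D m') - Real.log (D m)) := by
      refine Finset.sum_le_sum fun c hc => mul_le_mul_of_nonneg_left (by linarith)
        (div_nonneg (hDC c hc).le (Finset.sum_nonneg fun a ha => (hD a (hSA ha)).le))
    linarith
  calc ∑ m ∈ S, p m * (1 + ∑ m' ∈ S \ R m, D m' / ∑ b ∈ R m', D b)
      ≤ ∑ m ∈ S, p m * (1 + Real.log n + ∑ m' ∈ S \ R m,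
        D m' / (∑ b ∈ S, D b) * (Real.log (D m') - Real.log (D m))) :=
        Finset.sum_le_sum fun m hm => mul_le_mul_of_nonneg_left (hbound m hm) (hp0 m hm)
    _ = _ := by
        simp only [mul_add]
        rw [Finset.sum_add_distrib, Finset.sum_add_distrib, ← Finset.sum_mul, ← Finset.sum_mul,
          hsum1]
        ring

end Records

/-! ### Deferred acceptance as fixed points of a monotone map -/

section Proposals

variable {M W : Type*} [DecidableEq M] [DecidableEq W]

/-- The pairs `(m, w)` such that `w` rejects `m` when `P` is the set of proposals made. -/
def rejections (q : W → PrefList M) : Set (M × W) →o Set (M × W) where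
  toFun P := {x | x.1 ∉ (q x.2).1 ∨
    ∃ m, (m, x.2) ∈ P ∧ (q x.2).1.idxOf m < (q x.2).1.idxOf x.1}
  monotone' _ _ h _ hx := hx.imp_right fun ⟨m, hm, hlt⟩ => ⟨m, h hm, hlt⟩

/-- The proposals made when every man proposes to the women on his list, in the order of the list,
until he is not rejected. -/
def proposals (p : M → PrefList W) (rej : Set (M × W) →o Set (M × W)) :
    Set (M × W) →o Set (M × W) where
  toFun P := {x | x.2 ∈ (p x.1).1 ∧
    ∀ u, (p x.1).1.idxOf u < (p x.1).1.idxOf x.2 → (x.1, u) ∈ rej P}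
  monotone' _ _ h _ hx := ⟨hx.1, fun u hu => rej.monotone h (hx.2 u hu)⟩

lemma mem_rejections {q : W → PrefList M} {P : Set (M × W)} {m : M} {w : W} :
    (m, w) ∈ rejections q P ↔
      m ∉ (q w).1 ∨ ∃ m', (m', w) ∈ P ∧ (q w).1.idxOf m' < (q w).1.idxOf m := Iff.rfl

/-- `(m, w)` is a proposal which is not rejected. -/
def Accepted (rej : Set (M × W) →o Set (M × W)) (P : Set (M × W)) (m : M) (w : W) : Prop :=
  (m, w) ∈ P ∧ (m, w) ∉ rej P

section Fixed

variable {p : M → PrefList W} {q : W → PrefList M} {rej : Set (M × W) →o Set (M × W)}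
  {P P' : Set (M × W)}

lemma mem_of_idxOf_lt {α : Type*} [DecidableEq α] {l : List α} {a b : α}
    (h : l.idxOf a < l.idxOf b) : a ∈ l :=
  List.idxOf_lt_length_iff.1 (h.trans_le List.idxOf_le_length)

lemma mem_of_fixed (hP : proposals p rej P = P) {m : M} {w : W} (h : (m, w) ∈ P) :
    w ∈ (p m).1 := by
  rw [← hP] at h
  exact h.1

lemma mem_of_fixed_of_lt (hP : proposals p rej P = P) {m : M} {w u : W} (h : (m, w) ∈ P)
    (hu : (p m).1.idxOf u < (p m).1.idxOf w) : (m, u) ∈ P := by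
  rw [← hP] at h ⊢
  exact ⟨mem_of_idxOf_lt hu, fun v hv => h.2 v (hv.trans hu)⟩

lemma rejected_of_fixed_of_lt (hP : proposals p rej P = P) {m : M} {w u : W} (h : (m, w) ∈ P)
    (hu : (p m).1.idxOf u < (p m).1.idxOf w) : (m, u) ∈ rej P := by
  rw [← hP] at h
  exact h.2 u hu

/-- A man keeps proposing down his list until he is accepted; if he never is, he reaches every woman
on it. -/
lemma mem_fixed_of_accepted (hP : proposals p rej P = P) {m : M} {w : W} (hw : w ∈ (p m).1)
    (h : ∀ v, Accepted rej P m v → ¬ (p m).1.idxOf v < (p m).1.idxOf w) : (m, w) ∈ P := by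
  induction hn : (p m).1.idxOf w using Nat.strong_induction_on generalizing w with
  | _ n ih =>
    subst hn
    rw [← hP]
    refine ⟨hw, fun u hu => ?_⟩
    have hmem := ih _ hu (mem_of_idxOf_lt hu) (fun v hv hlt => h v hv (hlt.trans hu)) rfl
    by_contra hc
    exact h u ⟨hmem, hc⟩ hu

lemma Accepted.woman_unique (hP : proposals p rej P = P) {m : M} {u v : W}
    (hu : Accepted rej P m u) (hv : Accepted rej P m v) : u = v :=
  idxOf_injective_of_not_lt (mem_of_fixed hP hu.1)
    (fun h => hu.2 (rejected_of_fixed_of_lt hP hv.1 h))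
    (fun h => hv.2 (rejected_of_fixed_of_lt hP hu.1 h))

lemma Accepted.mem_list {m : M} {w : W} (h : Accepted (rejections q) P m w) : m ∈ (q w).1 := by
  by_contra hc
  exact h.2 (Or.inl hc)

lemma Accepted.not_lt {m m' : M} {w : W} (h : Accepted (rejections q) P m w) (hm' : (m', w) ∈ P) :
    ¬ (q w).1.idxOf m' < (q w).1.idxOf m :=
  fun hc => h.2 (Or.inr ⟨m', hm', hc⟩)

lemma Accepted.man_unique {m m' : M} {w : W} (h : Accepted (rejections q) P m w)
    (h' : Accepted (rejections q) P m' w) : m = m' :=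
  idxOf_injective_of_not_lt h.mem_list (h'.not_lt h.1) (h.not_lt h'.1)

lemma exists_accepted_le {m : M} {w : W} (hm : m ∈ (q w).1) (h : (m, w) ∈ P) :
    ∃ m', Accepted (rejections q) P m' w ∧ (q w).1.idxOf m' ≤ (q w).1.idxOf m := by
  induction hn : (q w).1.idxOf m using Nat.strong_induction_on generalizing m with
  | _ n ih =>
    subst hn
    by_cases hr : (m, w) ∈ rejections q P
    · obtain ⟨m', hm', hlt⟩ := hr.resolve_left (not_not.2 hm)
      obtain ⟨m'', h1, h2⟩ := ih _ hlt (mem_of_idxOf_lt hlt) hm' rfl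
      exact ⟨m'', h1, h2.trans hlt.le⟩
    · exact ⟨m, ⟨h, hr⟩, le_rfl⟩

/-- More proposals can only improve the situation of a woman; `Accepted.exists_wife_le` is the
opposite statement for men. -/
lemma Accepted.exists_husband_le {m : M} {w : W} (hPP' : P ⊆ P')
    (h : Accepted (rejections q) P m w) :
    ∃ m', Accepted (rejections q) P' m' w ∧ (q w).1.idxOf m' ≤ (q w).1.idxOf m :=
  exists_accepted_le h.mem_list (hPP' h.1)

lemma Accepted.exists_wife_le (hP : proposals p rej P = P) (hP' : proposals p rej P' = P')
    (hPP' : P ⊆ P') {m : M} {w : W} (h : Accepted rej P' m w) :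
    ∃ v, Accepted rej P m v ∧ ¬ (p m).1.idxOf w < (p m).1.idxOf v := by
  by_contra! hc
  have h1 := mem_fixed_of_accepted hP (mem_of_fixed hP' h.1) fun v hv => _root_.not_lt.2 (hc v hv).le
  exact lt_irrefl _ (hc w ⟨h1, fun h2 => h.2 (rej.monotone hPP' h2)⟩)

lemma ncard_accepted_men (hP : proposals p rej P = P) :
    {m | ∃ w, Accepted rej P m w}.ncard = {x : M × W | Accepted rej P x.1 x.2}.ncard := by
  rw [← Set.InjOn.ncard_image (f := Prod.fst) (s := {x : M × W | Accepted rej P x.1 x.2})]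
  · congr 1
    ext m
    simp
  · rintro ⟨m, w⟩ h ⟨m', w'⟩ h' (rfl : m = m')
    exact Prod.ext rfl (Accepted.woman_unique hP h h')

lemma ncard_accepted_women :
    {w | ∃ m, Accepted (rejections q) P m w}.ncard =
      {x : M × W | Accepted (rejections q) P x.1 x.2}.ncard := by
  rw [← Set.InjOn.ncard_image (f := Prod.snd)
    (s := {x : M × W | Accepted (rejections q) P x.1 x.2})]
  · congr 1
    ext m
    simp
  · rintro ⟨m, w⟩ h ⟨m', w'⟩ h' (rfl : w = w')
    exact Prod.ext (Accepted.man_unique h h') rfl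

variable [Fintype M] [Fintype W]

lemma ncard_accepted_men_le (hP : proposals p (rejections q) P = P) :
    {m | ∃ w, Accepted (rejections q) P m w}.ncard ≤ min (Fintype.card M) (Fintype.card W) := by
  refine le_min ?_ ?_
  · rw [← Nat.card_eq_fintype_card]
    exact Set.ncard_le_card _
  · rw [ncard_accepted_men hP, ← ncard_accepted_women, ← Nat.card_eq_fintype_card]
    exact Set.ncard_le_card _

/-- With more proposals the set of matched men shrinks and that of matched women grows, yet both
have as many elements as there are couples. Hence neither changes (the rural hospitals theorem). -/
lemma accepted_men_eq_and_women_eq (hP : proposals p (rejections q) P = P)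
    (hP' : proposals p (rejections q) P' = P') (hPP' : P ⊆ P') :
    {m | ∃ w, Accepted (rejections q) P' m w} = {m | ∃ w, Accepted (rejections q) P m w} ∧
    {w | ∃ m, Accepted (rejections q) P m w} = {w | ∃ m, Accepted (rejections q) P' m w} := by
  have h1 : {m | ∃ w, Accepted (rejections q) P' m w} ⊆ {m | ∃ w, Accepted (rejections q) P m w} := by
    rintro m ⟨w, h⟩
    obtain ⟨v, hv, -⟩ := h.exists_wife_le hP hP' hPP'
    exact ⟨v, hv⟩
  have h2 : {w | ∃ m, Accepted (rejections q) P m w} ⊆ {w | ∃ m, Accepted (rejections q) P' m w} := by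
    rintro w ⟨m, h⟩
    obtain ⟨v, hv, -⟩ := h.exists_husband_le hPP'
    exact ⟨v, hv⟩
  have h3 := Set.ncard_le_ncard h1 (Set.toFinite _)
  have h4 := Set.ncard_le_ncard h2 (Set.toFinite _)
  rw [ncard_accepted_men hP, ncard_accepted_men hP'] at h3
  rw [ncard_accepted_women, ncard_accepted_women] at h4
  constructor
  · refine Set.eq_of_subset_of_ncard_le h1 ?_ (Set.toFinite _)
    rwa [ncard_accepted_men hP, ncard_accepted_men hP']
  · refine Set.eq_of_subset_of_ncard_le h2 ?_ (Set.toFinite _)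
    rwa [ncard_accepted_women, ncard_accepted_women]

end Fixed

/-! ### Stable matchings correspond to fixed points -/

section Bridge

lemma PrefList.prefers_some_some {α : Type*} [DecidableEq α] {l : PrefList α} {a b : α}
    (hb : b ∈ l.1) : l.Prefers (some a) (some b) ↔ l.1.idxOf a < l.1.idxOf b := by
  have hb' := List.idxOf_lt_length_of_mem hb
  simp only [PrefList.Prefers, PrefList.position, hb, if_true]
  split_ifs with ha
  · rfl
  · rw [List.idxOf_eq_length ha]
    omega

lemma PrefList.prefers_some_none {α : Type*} [DecidableEq α] {l : PrefList α} {a : α} :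
    l.Prefers (some a) none ↔ a ∈ l.1 := by
  simp only [PrefList.Prefers, PrefList.position]
  split_ifs with ha
  · simpa [ha] using List.idxOf_lt_length_of_mem ha
  · simp [ha]

lemma PrefList.not_prefers_none_some {α : Type*} [DecidableEq α] {l : PrefList α} {a : α} :
    ¬ l.Prefers none (some a) ↔ a ∈ l.1 := by
  simp only [PrefList.Prefers, PrefList.position]
  split_ifs with ha
  · simpa [ha] using (List.idxOf_lt_length_of_mem ha).le
  · simp [ha]

lemma Matching.wife_eq_some_iff (μ : Matching M W) {m : M} {w : W} :
    μ.wife m = some w ↔ μ.toFun (Sum.inl m) = Sum.inr w := by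
  simp [Matching.wife, Sum.getRight?_eq_some_iff]

lemma Matching.husband_eq_some_iff (μ : Matching M W) {m : M} {w : W} :
    μ.husband w = some m ↔ μ.wife m = some w := by
  rw [μ.wife_eq_some_iff, Matching.husband, Sum.getLeft?_eq_some_iff]
  constructor
  · intro h
    rw [← h, μ.involutive]
  · intro h
    rw [← h, μ.involutive]

variable {p : M → PrefList W} {q : W → PrefList M}

lemma exists_fixed_of_isStable {μ : Matching M W} (hμ : μ.IsStable p q) :
    ∃ P, proposals p (rejections q) P = P ∧
      ∀ m w, Accepted (rejections q) P m w ↔ μ.wife m = some w := by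
  have hwl : ∀ {m w}, μ.wife m = some w → w ∈ (p m).1 := fun {m w} h =>
    PrefList.not_prefers_none_some.1 (h ▸ hμ.man_rational m)
  have hml : ∀ {m w}, μ.wife m = some w → m ∈ (q w).1 := fun {m w} h =>
    PrefList.not_prefers_none_some.1 (μ.husband_eq_some_iff.2 h ▸ hμ.woman_rational w)
  -- Each man proposes down to his wife, or to his whole list if single. Absence of blocking pairs
  -- then means that exactly the proposals outside the matching are rejected.
  set P : Set (M × W) := {x | x.2 ∈ (p x.1).1 ∧
    ∀ u, μ.wife x.1 = some u → ¬ (p x.1).1.idxOf u < (p x.1).1.idxOf x.2} with hPdef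
  have hmem : ∀ {m w}, μ.wife m = some w → (m, w) ∈ P := by
    intro m w h
    refine ⟨hwl h, fun u hu => ?_⟩
    simp only at hu ⊢
    rw [h, Option.some.injEq] at hu
    simp [hu]
  have hpref : ∀ {m w}, (m, w) ∈ P → μ.wife m ≠ some w →
      (p m).Prefers (some w) (μ.wife m) := by
    intro m w h hne
    cases hu : μ.wife m with
    | none => exact PrefList.prefers_some_none.2 h.1
    | some u =>
      rw [PrefList.prefers_some_some (hwl hu)]
      have h1 := h.2 u hu
      by_contra h2
      exact hne (hu.trans (congrArg some (idxOf_injective_of_not_lt (hwl hu) h1 h2)))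
  have hA : ∀ {m w}, (m, w) ∈ P → μ.wife m ≠ some w → (m, w) ∈ rejections q P := by
    intro m w h hne
    by_cases hm : m ∈ (q w).1
    · have h1 : ¬ (q w).Prefers (some m) (μ.husband w) :=
        fun h1 => hμ.no_blocking m w ⟨h1, hpref h hne⟩
      cases hu : μ.husband w with
      | none =>
        rw [hu] at h1
        exact absurd (PrefList.prefers_some_none.2 hm) h1
      | some m' =>
        have hm' := μ.husband_eq_some_iff.1 hu
        rw [hu, PrefList.prefers_some_some (hml hm')] at h1
        refine Or.inr ⟨m', hmem hm', ?_⟩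
        by_contra h2
        exact hne (idxOf_injective_of_not_lt hm h1 h2 ▸ hm')
    · exact Or.inl hm
  have hB : ∀ {m w}, μ.wife m = some w → (m, w) ∉ rejections q P := by
    rintro m w h (h1 | ⟨m', hm', hlt⟩)
    · exact h1 (hml h)
    · refine hμ.no_blocking m' w ⟨?_, hpref hm' fun h' => ?_⟩
      · rw [μ.husband_eq_some_iff.2 h, PrefList.prefers_some_some (hml h)]
        exact hlt
      · have := (μ.husband_eq_some_iff.2 h').symm.trans (μ.husband_eq_some_iff.2 h)
        rw [Option.some.injEq] at this
        simp [this] at hlt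
  refine ⟨P, ?_, fun m w => ⟨fun h => ?_, fun h => ⟨hmem h, hB h⟩⟩⟩
  · ext ⟨m, w⟩
    constructor
    · rintro ⟨h1, h2⟩
      exact ⟨h1, fun u hu hlt => hB hu (h2 u hlt)⟩
    · rintro ⟨h1, h2⟩
      refine ⟨h1, fun u hu => hA ⟨mem_of_idxOf_lt hu, fun v hv hlt => h2 v hv (hlt.trans hu)⟩ ?_⟩
      exact fun h => h2 u h hu
  · by_contra hc
    exact h.2 (hA h.1 hc)

open Classical in
/-- The matching given by a relation which is a partial bijection. -/
def Matching.ofRel (r : M → W → Prop) (hw : ∀ m w w', r m w → r m w' → w = w')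
    (hm : ∀ m m' w, r m w → r m' w → m = m') : Matching M W where
  toFun x := match x with
    | Sum.inl m => if h : ∃ w, r m w then Sum.inr h.choose else Sum.inl m
    | Sum.inr w => if h : ∃ m, r m w then Sum.inl h.choose else Sum.inr w
  involutive := by
    rintro (m | w)
    · by_cases h : ∃ w, r m w
      · have h' : ∃ m', r m' h.choose := ⟨m, h.choose_spec⟩
        simp only [h, dif_pos, h']
        rw [hm _ _ _ h'.choose_spec h.choose_spec]
      · simp [h]
    · by_cases h : ∃ m, r m w
      · have h' : ∃ w', r h.choose w' := ⟨w, h.choose_spec⟩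
        simp only [h, dif_pos, h']
        rw [hw _ _ _ h'.choose_spec h.choose_spec]
      · simp [h]
  man_or_self m := by
    by_cases h : ∃ w, r m w <;> simp [h]
  woman_or_self w := by
    by_cases h : ∃ m, r m w <;> simp [h]

lemma Matching.ofRel_wife {r : M → W → Prop} {hw : ∀ m w w', r m w → r m w' → w = w'}
    {hm : ∀ m m' w, r m w → r m' w → m = m'} {m : M} {w : W} :
    (Matching.ofRel r hw hm).wife m = some w ↔ r m w := by
  rw [Matching.wife_eq_some_iff]
  simp only [Matching.ofRel]
  by_cases h : ∃ w, r m w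
  · simp only [h, dif_pos, Sum.inr.injEq]
    exact ⟨fun h' => h' ▸ h.choose_spec, fun h' => hw _ _ _ h.choose_spec h'⟩
  · simp only [h, dif_neg, not_false_eq_true, reduceCtorEq, false_iff]
    exact fun h' => h ⟨w, h'⟩

/-- A woman whom `m` prefers to his situation has received his proposal, so the man she accepted is
at least as good for her: no pair blocks. -/
lemma exists_isStable_of_fixed {P : Set (M × W)} (hP : proposals p (rejections q) P = P) :
    ∃ μ : Matching M W, μ.IsStable p q ∧
      ∀ m w, μ.wife m = some w ↔ Accepted (rejections q) P m w := by
  refine ⟨Matching.ofRel (Accepted (rejections q) P) (fun m w w' h h' => h.woman_unique hP h')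
    (fun m m' w h h' => h.man_unique h'), ?_, fun m w => Matching.ofRel_wife⟩
  set μ := Matching.ofRel (Accepted (rejections q) P) (fun m w w' h h' => h.woman_unique hP h')
    (fun m m' w h h' => h.man_unique h') with hμ
  have hwife : ∀ {m w}, μ.wife m = some w ↔ Accepted (rejections q) P m w := Matching.ofRel_wife
  have hhus : ∀ {m w}, μ.husband w = some m ↔ Accepted (rejections q) P m w :=
    (μ.husband_eq_some_iff).trans hwife
  refine ⟨fun m => ?_, fun w => ?_, fun m w => ?_⟩
  · cases h : μ.wife m with
    | none => simp [PrefList.Prefers]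
    | some w => exact PrefList.not_prefers_none_some.2 (mem_of_fixed hP (hwife.1 h).1)
  · cases h : μ.husband w with
    | none => simp [PrefList.Prefers]
    | some m => exact PrefList.not_prefers_none_some.2 (hhus.1 h).mem_list
  · rintro ⟨h1, h2⟩
    have hw : w ∈ (p m).1 := by
      cases h : μ.wife m with
      | none => exact PrefList.prefers_some_none.1 (h ▸ h2)
      | some u =>
        rw [h, PrefList.prefers_some_some (mem_of_fixed hP (hwife.1 h).1)] at h2
        exact mem_of_idxOf_lt h2
    have hm : m ∈ (q w).1 := by
      cases h : μ.husband w with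
      | none => exact PrefList.prefers_some_none.1 (h ▸ h1)
      | some u =>
        rw [h, PrefList.prefers_some_some (hhus.1 h).mem_list] at h1
        exact mem_of_idxOf_lt h1
    have hmw : (m, w) ∈ P := by
      refine mem_fixed_of_accepted hP hw fun v hv => ?_
      rw [hwife.2 hv, PrefList.prefers_some_some (mem_of_fixed hP hv.1)] at h2
      omega
    obtain ⟨m', hm', hle⟩ := exists_accepted_le hm hmw
    rw [hhus.2 hm', PrefList.prefers_some_some hm'.mem_list] at h1
    omega

/-- Stable pairs are the accepted proposals of the fixed points of the proposal map. -/
lemma isStablePair_iff {m : M} {w : W} : IsStablePair p q m w ↔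
    ∃ P, proposals p (rejections q) P = P ∧ Accepted (rejections q) P m w := by
  constructor
  · rintro ⟨μ, hμ, h⟩
    obtain ⟨P, hP, hPμ⟩ := exists_fixed_of_isStable hμ
    exact ⟨P, hP, (hPμ m w).2 h⟩
  · rintro ⟨P, hP, h⟩
    obtain ⟨μ, hμ, hPμ⟩ := exists_isStable_of_fixed hP
    exact ⟨μ, hμ, (hPμ m w).2 h⟩

lemma IsStablePair.mem_woman_list {m : M} {w : W} (h : IsStablePair p q m w) : m ∈ (q w).1 := by
  obtain ⟨P, -, h⟩ := isStablePair_iff.1 h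
  exact h.mem_list

lemma IsStablePair.mem_man_list {m : M} {w : W} (h : IsStablePair p q m w) : w ∈ (p m).1 := by
  obtain ⟨P, hP, h⟩ := isStablePair_iff.1 h
  exact mem_of_fixed hP h.1

lemma IsStablePair.swap {m : M} {w : W} (h : IsStablePair p q m w) : IsStablePair q p w m := by
  obtain ⟨μ, hμ, h⟩ := h
  let ν : Matching W M :=
    { toFun := fun x => (μ.toFun x.swap).swap
      involutive := fun x => by simp [μ.involutive (Sum.swap x)]
      man_or_self := fun w => by
        rcases μ.woman_or_self w with h | ⟨m, h⟩ <;> simp [h]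
      woman_or_self := fun m => by
        rcases μ.man_or_self m with h | ⟨w, h⟩ <;> simp [h] }
  have h1 : ∀ w, ν.wife w = μ.husband w := fun w => by
    simp only [Matching.wife, Matching.husband, ν, Sum.swap_inl]
    cases μ.toFun (Sum.inr w) <;> rfl
  have h2 : ∀ m, ν.husband m = μ.wife m := fun w => by
    simp only [Matching.wife, Matching.husband, ν, Sum.swap_inr]
    cases μ.toFun (Sum.inl w) <;> rfl
  refine ⟨ν, ⟨fun w => ?_, fun m => ?_, fun w m hb => ?_⟩, ?_⟩
  · rw [h1]; exact hμ.woman_rational w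
  · rw [h2]; exact hμ.man_rational m
  · rw [h1, h2] at hb
    exact hμ.no_blocking m w ⟨hb.2, hb.1⟩
  · rw [h1]; exact μ.husband_eq_some_iff.2 h

lemma isStablePair_swap (p : M → PrefList W) (q : W → PrefList M) {m : M} {w : W} :
    IsStablePair q p w m ↔ IsStablePair p q m w :=
  ⟨IsStablePair.swap, IsStablePair.swap⟩

end Bridge

end Proposals

/-! ### Extremal stable matchings -/

section Extremal

variable {M W : Type*} [DecidableEq M] [DecidableEq W] [Fintype M] [Fintype W]
  {p : M → PrefList W} {q : W → PrefList M}

/-- The greatest fixed point has the most proposals, so it is best for the women and worst for the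
men; the least one is the reverse. Where a partner in the extremal matching is not supplied by
monotonicity, it comes from `accepted_men_eq_and_women_eq`. -/
lemma isBest_iff_accepted_gfp {m : M} {w : W} :
    IsBest (q w).1 (fun m' => IsStablePair p q m' w) m ↔
      Accepted (rejections q) (OrderHom.gfp (proposals p (rejections q))) m w := by
  set P' := OrderHom.gfp (proposals p (rejections q)) with hP'def
  have hP' : proposals p (rejections q) P' = P' := OrderHom.map_gfp _
  have h1 : ∀ {m}, Accepted (rejections q) P' m w →
      IsBest (q w).1 (fun m' => IsStablePair p q m' w) m := by
    refine fun {m} h => ⟨isStablePair_iff.2 ⟨P', hP', h⟩, fun m' hm' => ?_⟩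
    obtain ⟨P, hP, hPm'⟩ := isStablePair_iff.1 hm'
    obtain ⟨m'', h1, h2⟩ := hPm'.exists_husband_le (OrderHom.le_gfp _ hP.ge : P ⊆ P')
    rw [h.man_unique h1]
    exact not_lt.2 h2
  refine ⟨fun h => ?_, h1⟩
  obtain ⟨P, hP, hPm⟩ := isStablePair_iff.1 h.1
  obtain ⟨m', hm', -⟩ := hPm.exists_husband_le (OrderHom.le_gfp _ hP.ge : P ⊆ P')
  rwa [isBest_unique (fun _ ha => ha.mem_woman_list) h (h1 hm')]

lemma isWorst_iff_accepted_gfp {m : M} {w : W} :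
    IsWorst (p m).1 (IsStablePair p q m) w ↔
      Accepted (rejections q) (OrderHom.gfp (proposals p (rejections q))) m w := by
  set P' := OrderHom.gfp (proposals p (rejections q)) with hP'def
  have hP' : proposals p (rejections q) P' = P' := OrderHom.map_gfp _
  have h1 : ∀ {w}, Accepted (rejections q) P' m w → IsWorst (p m).1 (IsStablePair p q m) w := by
    refine fun {w} h => ⟨isStablePair_iff.2 ⟨P', hP', h⟩, fun w' hw' => ?_⟩
    obtain ⟨P, hP, hPw'⟩ := isStablePair_iff.1 hw'
    obtain ⟨v, h1, h2⟩ := h.exists_wife_le hP hP' (OrderHom.le_gfp _ hP.ge : P ⊆ P')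
    rwa [hPw'.woman_unique hP h1]
  refine ⟨fun h => ?_, h1⟩
  obtain ⟨P, hP, hPw⟩ := isStablePair_iff.1 h.1
  have hm : m ∈ {m | ∃ w, Accepted (rejections q) P m w} := ⟨w, hPw⟩
  rw [← (accepted_men_eq_and_women_eq hP hP' (OrderHom.le_gfp _ hP.ge)).1] at hm
  obtain ⟨w', hw'⟩ := hm
  rwa [isWorst_unique (fun _ ha => ha.mem_man_list) h (h1 hw')]

lemma isWorst_iff_accepted_lfp {m : M} {w : W} :
    IsWorst (q w).1 (fun m' => IsStablePair p q m' w) m ↔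
      Accepted (rejections q) (OrderHom.lfp (proposals p (rejections q))) m w := by
  set P' := OrderHom.lfp (proposals p (rejections q)) with hP'def
  have hP' : proposals p (rejections q) P' = P' := OrderHom.map_lfp _
  have h1 : ∀ {m}, Accepted (rejections q) P' m w →
      IsWorst (q w).1 (fun m' => IsStablePair p q m' w) m := by
    refine fun {m} h => ⟨isStablePair_iff.2 ⟨P', hP', h⟩, fun m' hm' => ?_⟩
    obtain ⟨P, hP, hPm'⟩ := isStablePair_iff.1 hm'
    obtain ⟨m'', h1, h2⟩ := h.exists_husband_le (OrderHom.lfp_le _ hP.le : P' ⊆ P)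
    rw [hPm'.man_unique h1]
    exact not_lt.2 h2
  refine ⟨fun h => ?_, h1⟩
  obtain ⟨P, hP, hPm⟩ := isStablePair_iff.1 h.1
  have hw : w ∈ {w | ∃ m, Accepted (rejections q) P m w} := ⟨m, hPm⟩
  rw [← (accepted_men_eq_and_women_eq hP' hP (OrderHom.lfp_le _ hP.le)).2] at hw
  obtain ⟨m', hm'⟩ := hw
  rwa [isWorst_unique (fun _ ha => ha.mem_woman_list) h (h1 hm')]

lemma isBest_iff_accepted_lfp {m : M} {w : W} :
    IsBest (p m).1 (IsStablePair p q m) w ↔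
      Accepted (rejections q) (OrderHom.lfp (proposals p (rejections q))) m w := by
  set P' := OrderHom.lfp (proposals p (rejections q)) with hP'def
  have hP' : proposals p (rejections q) P' = P' := OrderHom.map_lfp _
  have h1 : ∀ {w}, Accepted (rejections q) P' m w → IsBest (p m).1 (IsStablePair p q m) w := by
    refine fun {w} h => ⟨isStablePair_iff.2 ⟨P', hP', h⟩, fun w' hw' => ?_⟩
    obtain ⟨P, hP, hPw'⟩ := isStablePair_iff.1 hw'
    obtain ⟨v, h1, h2⟩ := hPw'.exists_wife_le hP' hP (OrderHom.lfp_le _ hP.le : P' ⊆ P)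
    rwa [h.woman_unique hP' h1]
  refine ⟨fun h => ?_, h1⟩
  obtain ⟨P, hP, hPw⟩ := isStablePair_iff.1 h.1
  obtain ⟨w', hw', -⟩ := hPw.exists_wife_le hP' hP (OrderHom.lfp_le _ hP.le : P' ⊆ P)
  rwa [isBest_unique (fun _ ha => ha.mem_man_list) h (h1 hw')]

/-- The best stable husband of `w` is `m` if and only if the worst stable wife of `m` is `w`. -/
lemma isBest_husband_iff_isWorst_wife {m : M} {w : W} :
    IsBest (q w).1 (fun m' => IsStablePair p q m' w) m ↔
      IsWorst (p m).1 (IsStablePair p q m) w :=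
  isBest_iff_accepted_gfp.trans isWorst_iff_accepted_gfp.symm

/-- The worst stable husband of `w` is `m` if and only if the best stable wife of `m` is `w`. -/
lemma isWorst_husband_iff_isBest_wife {m : M} {w : W} :
    IsWorst (q w).1 (fun m' => IsStablePair p q m' w) m ↔
      IsBest (p m).1 (IsStablePair p q m) w :=
  isWorst_iff_accepted_lfp.trans isBest_iff_accepted_lfp.symm

lemma ncard_women_with_stable_husband_le :
    {w | ∃ m, IsStablePair p q m w}.ncard ≤ min (Fintype.card M) (Fintype.card W) := by
  set P' := OrderHom.gfp (proposals p (rejections q)) with hP'def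
  have hP' : proposals p (rejections q) P' = P' := OrderHom.map_gfp _
  refine le_trans ?_ (ncard_accepted_men_le hP')
  rw [ncard_accepted_men hP', ← ncard_accepted_women]
  refine Set.ncard_le_ncard ?_ (Set.toFinite _)
  rintro w ⟨m, h⟩
  obtain ⟨P, hP, hPm⟩ := isStablePair_iff.1 h
  obtain ⟨m', hm', -⟩ := hPm.exists_husband_le (OrderHom.le_gfp _ hP.ge : P ⊆ P')
  exact ⟨m', hm'⟩

end Extremal

/-! ### The men proposing to one woman, independently of her own list -/

section Suitors

variable {M W : Type*} [DecidableEq M] [DecidableEq W]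

/-- The rejections when `w` rejects exactly the men of `B`. -/
def rejectionsAt (q : W → PrefList M) (w : W) (B : Set M) : Set (M × W) →o Set (M × W) where
  toFun P := {x | (x.2 = w ∧ x.1 ∈ B) ∨ (x.2 ≠ w ∧ x ∈ rejections q P)}
  monotone' _ _ h _ hx := hx.imp_right fun ⟨h1, h2⟩ => ⟨h1, (rejections q).monotone h h2⟩

/-- The men who propose to `w` when `w` rejects exactly the men of `B`. -/
def suitors (p : M → PrefList W) (q : W → PrefList M) (w : W) (B : Set M) : Set M :=
  {m | (m, w) ∈ OrderHom.lfp (proposals p (rejectionsAt q w B))}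

variable {p : M → PrefList W} {q : W → PrefList M} {w : W}

lemma mem_rejectionsAt_self {B : Set M} {P : Set (M × W)} {m : M} :
    (m, w) ∈ rejectionsAt q w B P ↔ m ∈ B := by
  change (w = w ∧ m ∈ B) ∨ _ ↔ _
  simp

lemma mem_rejectionsAt_of_ne {B : Set M} {P : Set (M × W)} {m : M} {u : W} (hu : u ≠ w) :
    (m, u) ∈ rejectionsAt q w B P ↔ (m, u) ∈ rejections q P := by
  change (u = w ∧ m ∈ B) ∨ (u ≠ w ∧ _) ↔ _
  simp [hu]

lemma rejectionsAt_update (q : W → PrefList M) (w : W) (B : Set M) (l : PrefList M) :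
    rejectionsAt (Function.update q w l) w B = rejectionsAt q w B := by
  ext P ⟨m, u⟩
  by_cases hu : u = w
  · subst hu
    rw [mem_rejectionsAt_self, mem_rejectionsAt_self]
  · rw [mem_rejectionsAt_of_ne hu, mem_rejectionsAt_of_ne hu, mem_rejections, mem_rejections,
      Function.update_of_ne hu]

/-- With the other lists fixed, the competition for `w` is thus deterministic, while her own list is
still an independent draw. -/
lemma suitors_update (p : M → PrefList W) (q : W → PrefList M) (w : W) (B : Set M)
    (l : PrefList M) : suitors p (Function.update q w l) w B = suitors p q w B := by
  rw [suitors, suitors, rejectionsAt_update]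

/-- The rejection rules at `w` need comparing only on men who actually propose to her: a man whose
path passes `w` has been rejected by all women before her, hence belongs to her proposers in `P`. -/
lemma proposals_subset_of_fixed {rej rej' : Set (M × W) →o Set (M × W)} {P : Set (M × W)}
    (hP : proposals p rej' P = P)
    (hne : ∀ m u, u ≠ w → (m, u) ∈ rej P → (m, u) ∈ rej' P)
    (hw : ∀ m, (m, w) ∈ P → (m, w) ∈ rej P → (m, w) ∈ rej' P) : proposals p rej P ⊆ P := by
  rintro ⟨a, u⟩ ⟨h1, h2⟩
  rw [← hP]
  refine ⟨h1, fun v hv => ?_⟩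
  by_cases hvw : v = w
  · subst hvw
    refine hw a ?_ (h2 v hv)
    rw [← hP]
    refine ⟨mem_of_idxOf_lt hv, fun v' hv' => hne a v' ?_ (h2 v' (hv'.trans hv))⟩
    rintro rfl
    exact lt_irrefl _ hv'
  · exact hne a v hvw (h2 v hv)

lemma fixed_of_fixed {rej rej' : Set (M × W) →o Set (M × W)} {P : Set (M × W)}
    (hP : proposals p rej' P = P)
    (hne : ∀ m u, u ≠ w → ((m, u) ∈ rej P ↔ (m, u) ∈ rej' P))
    (hw : ∀ m, (m, w) ∈ P → ((m, w) ∈ rej P ↔ (m, w) ∈ rej' P)) : proposals p rej P = P := by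
  refine Set.Subset.antisymm (proposals_subset_of_fixed hP (fun m u hu => (hne m u hu).1)
    (fun m hm => (hw m hm).1)) ?_
  rintro ⟨a, u⟩ h
  refine ⟨mem_of_fixed hP h, fun v hv => ?_⟩
  have h1 := rejected_of_fixed_of_lt hP h hv
  by_cases hvw : v = w
  · subst hvw
    exact (hw a (mem_of_fixed_of_lt hP h hv)).2 h1
  · exact (hne a v hvw).2 h1

lemma suitors_subset {B B' : Set M} (h : suitors p q w B' ∩ B ⊆ B') :
    suitors p q w B ⊆ suitors p q w B' := by
  have : OrderHom.lfp (proposals p (rejectionsAt q w B)) ≤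
      OrderHom.lfp (proposals p (rejectionsAt q w B')) := by
    refine OrderHom.lfp_le _ (proposals_subset_of_fixed (w := w) (OrderHom.map_lfp _)
      (fun m u hu => ?_) (fun m hm => ?_))
    · rw [mem_rejectionsAt_of_ne hu, mem_rejectionsAt_of_ne hu]
      exact id
    · rw [mem_rejectionsAt_self, mem_rejectionsAt_self]
      exact fun hB => h ⟨hm, hB⟩
  exact fun m hm => this hm

lemma suitors_mono {B B' : Set M} (h : B ⊆ B') : suitors p q w B ⊆ suitors p q w B' :=
  suitors_subset (Set.inter_subset_right.trans h)

/-- If `m` did not propose when spared, rejecting him as well would change nothing, and he would not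
propose under total rejection either. -/
lemma mem_suitors_compl_self {m : M} (h : m ∈ suitors p q w Set.univ) :
    m ∈ suitors p q w {m}ᶜ := by
  by_contra hc
  refine hc (suitors_subset ?_ h)
  rintro a ⟨ha, -⟩ (rfl : a = m)
  exact hc ha

/-- As `m'` does not propose when only `m` is spared, sparing `m'` too changes nothing; rejecting
`m` afterwards only adds suitors. -/
lemma suitors_compl_subset {m m' : M} (h : m' ∉ suitors p q w {m}ᶜ) :
    suitors p q w {m}ᶜ ⊆ suitors p q w {m'}ᶜ := by
  have h1 : suitors p q w ({m}ᶜ ∩ {m'}ᶜ) ⊆ suitors p q w {m}ᶜ :=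
    suitors_mono Set.inter_subset_left
  refine (suitors_subset ?_).trans (suitors_mono (Set.inter_subset_right (s := {m}ᶜ)))
  rintro a ⟨ha, ha'⟩
  refine ⟨ha', ?_⟩
  rintro (rfl : a = m')
  exact h (h1 ha)

lemma mem_list_of_mem_suitors {B : Set M} {m : M} (h : m ∈ suitors p q w B) : w ∈ (p m).1 :=
  mem_of_fixed (OrderHom.map_lfp _) h

/-- The preference list on which only `m` is acceptable. -/
def PrefList.single (m : M) : PrefList M := ⟨[m], List.nodup_singleton m⟩

lemma PrefList.single_val (m : M) : (PrefList.single m).1 = [m] := rfl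

/-- Rejecting everybody but `m` is ordinary behaviour for a modified list, so the counting lemmas on
`rejections` become available. -/
lemma rejections_update_single (q : W → PrefList M) (w : W) (m : M) :
    rejections (Function.update q w (PrefList.single m)) = rejectionsAt q w {m}ᶜ := by
  ext P ⟨a, u⟩
  by_cases hu : u = w
  · subst hu
    rw [mem_rejectionsAt_self, mem_rejections, Function.update_self,
      PrefList.single_val]
    simp only [List.mem_singleton, Set.mem_compl_iff, Set.mem_singleton_iff, or_iff_left_iff_imp]
    rintro ⟨m', -, hlt⟩ rfl
    simp at hlt
  · rw [mem_rejectionsAt_of_ne hu, mem_rejections, mem_rejections, Function.update_of_ne hu]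

variable [Fintype M] [Fintype W]

/-- `m` is a stable husband of `w` if and only if he is her favourite among the men who propose to
her when she rejects all men but `m`. -/
lemma isStablePair_iff_suitors {m : M} : IsStablePair p q m w ↔
    m ∈ (q w).1 ∧ m ∈ suitors p q w {m}ᶜ ∧
      ∀ a ∈ suitors p q w {m}ᶜ, ¬ (q w).1.idxOf a < (q w).1.idxOf m := by
  set P' := OrderHom.lfp (proposals p (rejectionsAt q w {m}ᶜ)) with hP'def
  have hP' : proposals p (rejectionsAt q w {m}ᶜ) P' = P' := OrderHom.map_lfp _
  constructor
  · intro h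
    obtain ⟨P, hP, hPm⟩ := isStablePair_iff.1 h
    -- In `P` the woman `w` rejects every proposer except `m`, so both rules act alike on `P`.
    have hfix : proposals p (rejectionsAt q w {m}ᶜ) P = P := by
      refine fixed_of_fixed (w := w) hP (fun a u hu => mem_rejectionsAt_of_ne hu) fun a ha => ?_
      rw [mem_rejectionsAt_self]
      constructor
      · intro hne
        by_contra hc
        exact hne (Accepted.man_unique (⟨ha, hc⟩ : Accepted (rejections q) P a w) hPm)
      · rintro hr (rfl : a = m)
        exact hPm.2 hr
    have hsub : P' ⊆ P := OrderHom.lfp_le _ hfix.le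
    refine ⟨h.mem_woman_list, ?_, fun a ha => hPm.not_lt (hsub ha)⟩
    have hacc : Accepted (rejections (Function.update q w (PrefList.single m))) P m w := by
      rw [rejections_update_single]
      exact ⟨hPm.1, fun h => mem_rejectionsAt_self.1 h rfl⟩
    rw [← rejections_update_single] at hP' hfix
    -- Since `w` is matched in `P`, she is matched in the least fixed point too, and there she can
    -- only accept `m`.
    obtain ⟨m', hm'⟩ := (accepted_men_eq_and_women_eq hP' hfix hsub).2.ge ⟨m, hacc⟩
    have := hm'.mem_list
    rw [Function.update_self, PrefList.single_val, List.mem_singleton] at this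
    subst this
    exact hm'.1
  · rintro ⟨h1, h2, h3⟩
    refine isStablePair_iff.2 ⟨P', ?_, h2, ?_⟩
    · refine fixed_of_fixed (w := w) hP' (fun a u hu => (mem_rejectionsAt_of_ne hu).symm)
        fun a ha => ?_
      rw [mem_rejectionsAt_self]
      constructor
      · rintro hr (rfl : a = m)
        rcases hr with hr | ⟨m', hm', hlt⟩
        · exact hr h1
        · exact h3 m' hm' hlt
      · intro hne
        refine Or.inr ⟨m, h2, ?_⟩
        by_contra hc
        exact hne (idxOf_injective_of_not_lt h1 hc (h3 a ha)).symm
    · rintro (hr | ⟨m', hm', hlt⟩)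
      · exact hr h1
      · exact h3 m' hm' hlt

/-- A man of `C` has `w` on his list but does not reach her when `m` is spared, so another woman
accepts him. Together with `m`, accepted by `w`, these men are matched in a single fixed point. -/
lemma card_suitors_sdiff_le {m : M} (hm : m ∈ suitors p q w Set.univ) {C : Finset M}
    (hC : ∀ a ∈ C, a ∈ suitors p q w Set.univ ∧ a ∉ suitors p q w {m}ᶜ) :
    1 + C.card ≤ min (Fintype.card M) (Fintype.card W) := by
  set P' := OrderHom.lfp (proposals p (rejectionsAt q w {m}ᶜ)) with hP'def
  have hP' : proposals p (rejectionsAt q w {m}ᶜ) P' = P' := OrderHom.map_lfp _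
  have hm' := mem_suitors_compl_self hm
  have hsub : ((insert m C : Finset M) : Set M) ⊆
      {m' | ∃ u, Accepted (rejectionsAt q w {m}ᶜ) P' m' u} := by
    intro a ha
    rcases Finset.mem_insert.1 (Finset.mem_coe.1 ha) with rfl | ha
    · exact ⟨w, hm', fun h => mem_rejectionsAt_self.1 h rfl⟩
    · by_contra hc
      refine (hC a ha).2 (mem_fixed_of_accepted hP' (mem_list_of_mem_suitors (hC a ha).1) ?_)
      exact fun v hv => absurd ⟨v, hv⟩ hc
  have hcard := Set.ncard_le_ncard hsub (Set.toFinite _)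
  rw [Set.ncard_coe_finset, Finset.card_insert_of_notMem fun h => (hC m h).2 hm'] at hcard
  rw [← rejections_update_single] at hP' hcard
  exact (add_comm _ _).le.trans (hcard.trans (ncard_accepted_men_le hP'))

open Classical in
/-- The men of `A` who propose to `w` when `w` rejects exactly the men of `B`. -/
def suitorsIn (p : M → PrefList W) (q : W → PrefList M) (w : W) (A : Finset M) (B : Set M) :
    Finset M := A.filter (· ∈ suitors p q w B)

lemma mem_suitorsIn {A : Finset M} {B : Set M} {m : M} :
    m ∈ suitorsIn p q w A B ↔ m ∈ A ∧ m ∈ suitors p q w B := by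
  simp [suitorsIn]

lemma suitorsIn_update (p : M → PrefList W) (q : W → PrefList M) (w : W) (A : Finset M)
    (B : Set M) (l : PrefList M) :
    suitorsIn p (Function.update q w l) w A B = suitorsIn p q w A B := by
  rw [suitorsIn, suitorsIn, suitors_update]

lemma isCompetition_suitorsIn (p : M → PrefList W) (q : W → PrefList M) (w : W)
    (A : Finset M) :
    IsCompetition (suitorsIn p q w A Set.univ) (fun m => suitorsIn p q w A {m}ᶜ) where
  self_mem m hm := by
    rw [mem_suitorsIn] at hm ⊢
    exact ⟨hm.1, mem_suitors_compl_self hm.2⟩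
  subset m _ a ha := by
    rw [mem_suitorsIn] at ha ⊢
    exact ⟨ha.1, suitors_mono (Set.subset_univ _) ha.2⟩
  chain m _ m' hm' h a ha := by
    rw [mem_suitorsIn] at hm' h ha ⊢
    exact ⟨ha.1, suitors_compl_subset (fun h' => h ⟨hm'.1, h'⟩) ha.2⟩

lemma isStablePair_iff_wins {A : Finset M} (hA : ∀ a, a ∈ (q w).1 ↔ a ∈ A) {m : M} :
    IsStablePair p q m w ↔
      Wins (suitorsIn p q w A Set.univ) (fun m => suitorsIn p q w A {m}ᶜ) (q w).1 m := by
  rw [isStablePair_iff_suitors, Wins, head?_filter_mem_eq_some_iff]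
  constructor
  · rintro ⟨h1, h2, h3⟩
    have hmA := (hA m).1 h1
    exact ⟨mem_suitorsIn.2 ⟨hmA, suitors_mono (Set.subset_univ _) h2⟩, h1,
      mem_suitorsIn.2 ⟨hmA, h2⟩, fun a ha => h3 a (mem_suitorsIn.1 ha).2⟩
  · rintro ⟨-, h2, h3, h4⟩
    refine ⟨h2, (mem_suitorsIn.1 h3).2, fun a ha hlt => ?_⟩
    exact h4 a (mem_suitorsIn.2 ⟨(hA a).1 (mem_of_idxOf_lt hlt), ha⟩) hlt

end Suitors

/-! ### Expectations over independent profiles and the popularity gain -/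

section ProfileMean

variable {M W : Type*} [DecidableEq M] [DecidableEq W] [Fintype M] [Fintype W]

/-- The probability of the profile `q` when all lists are drawn independently. -/
def profileProb (A : W → Finset M) (D : W → M → ℝ) (q : W → PrefList M) : ℝ :=
  ∏ w, drawProb (D w) (A w) (q w).1

/-- The expectation of `g q` for a profile `q` of independently drawn lists. -/
def profileMean (A : W → Finset M) (D : W → M → ℝ) (g : (W → PrefList M) → ℝ) : ℝ :=
  ∑ q, profileProb A D q * g q

variable {A : W → Finset M} {D : W → M → ℝ}

lemma profileProb_nonneg (hD : ∀ w, ∀ m ∈ A w, 0 < D w m) (q : W → PrefList M) :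
    0 ≤ profileProb A D q :=
  Finset.prod_nonneg fun w _ => drawProb_nonneg (hD w) _

lemma mem_iff_of_profileProb_ne_zero {q : W → PrefList M} (h : profileProb A D q ≠ 0)
    (w : W) (m : M) : m ∈ (q w).1 ↔ m ∈ A w :=
  mem_iff_of_drawProb_ne_zero (Finset.prod_ne_zero_iff.1 h w (Finset.mem_univ w)) m

lemma sum_drawProb {w : W} (hD : ∀ m ∈ A w, 0 < D w m) :
    ∑ l : PrefList M, drawProb (D w) (A w) l.1 = 1 := by
  have := drawMean_const hD 1
  simpa [drawMean] using this

lemma profileMean_const (hD : ∀ w, ∀ m ∈ A w, 0 < D w m) (c : ℝ) :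
    profileMean A D (fun _ => c) = c := by
  have h1 : ∑ q, profileProb A D q = 1 :=
    (Fintype.prod_sum fun w (l : PrefList M) => drawProb (D w) (A w) l.1).symm.trans
      (Finset.prod_eq_one fun w _ => sum_drawProb (hD w))
  rw [profileMean, ← Finset.sum_mul, h1, one_mul]

lemma profileMean_add (f g : (W → PrefList M) → ℝ) :
    profileMean A D (fun q => f q + g q) = profileMean A D f + profileMean A D g := by
  simp only [profileMean, mul_add, Finset.sum_add_distrib]

lemma profileMean_sum {ι : Type*} (s : Finset ι) (g : ι → (W → PrefList M) → ℝ) :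
    profileMean A D (fun q => ∑ i ∈ s, g i q) = ∑ i ∈ s, profileMean A D (g i) := by
  simp only [profileMean, Finset.mul_sum]
  exact Finset.sum_comm

lemma profileMean_mono (hD : ∀ w, ∀ m ∈ A w, 0 < D w m) {f g : (W → PrefList M) → ℝ}
    (h : ∀ q, (∀ w m, m ∈ (q w).1 ↔ m ∈ A w) → f q ≤ g q) :
    profileMean A D f ≤ profileMean A D g := by
  refine Finset.sum_le_sum fun q _ => ?_
  by_cases h0 : profileProb A D q = 0
  · simp [h0]
  · exact mul_le_mul_of_nonneg_left (h q (mem_iff_of_profileProb_ne_zero h0))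
      (profileProb_nonneg hD _)

lemma mul_eq_sum_of_sum_eq_one {ι : Type*} [Fintype ι] {f : ι → ℝ} (hf : ∑ i, f i = 1)
    (a c : ℝ) : a * c = ∑ i, a * (f i * c) := by
  rw [← Finset.mul_sum, ← Finset.sum_mul, hf, one_mul]

/-- The list of `w` may be drawn after all other lists. -/
lemma profileMean_eq_update (w : W) (hD : ∀ m ∈ A w, 0 < D w m) (g : (W → PrefList M) → ℝ) :
    profileMean A D g = profileMean A D
      (fun q => ∑ l : PrefList M, drawProb (D w) (A w) l.1 * g (Function.update q w l)) := by
  -- An independent second copy of the list of `w` is added; exchanging the two copies preserves the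
  -- joint weight.
  have hinv : Function.Involutive (fun x : (W → PrefList M) × PrefList M =>
      (Function.update x.1 w x.2, x.1 w)) := by
    rintro ⟨q, l⟩
    simp
  have h1 : profileMean A D g = ∑ x : (W → PrefList M) × PrefList M,
      profileProb A D x.1 * (drawProb (D w) (A w) x.2.1 * g x.1) := by
    rw [Fintype.sum_prod_type]
    refine Finset.sum_congr rfl fun q _ => ?_
    exact mul_eq_sum_of_sum_eq_one (sum_drawProb hD) _ _
  rw [h1, ← Equiv.sum_comp hinv.toPerm, Fintype.sum_prod_type]
  refine Finset.sum_congr rfl fun q _ => ?_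
  rw [Finset.mul_sum]
  refine Finset.sum_congr rfl fun l _ => ?_
  simp only [Function.Involutive.coe_toPerm]
  rw [← mul_assoc, ← mul_assoc]
  congr 1
  unfold profileProb
  rw [← Finset.mul_prod_erase _ _ (Finset.mem_univ w),
    ← Finset.mul_prod_erase _ (fun u => drawProb (D u) (A u) (q u).1) (Finset.mem_univ w),
    Function.update_self]
  have : ∏ u ∈ Finset.univ.erase w, drawProb (D u) (A u) (Function.update q w l u).1 =
      ∏ u ∈ Finset.univ.erase w, drawProb (D u) (A u) (q u).1 :=
    Finset.prod_congr rfl fun u hu => by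
      rw [Function.update_of_ne (Finset.ne_of_mem_erase hu)]
  rw [this]
  ring

open Classical in
lemma sum_isBest {α : Type*} [DecidableEq α] [Fintype α] {l : List α} {T : α → Prop}
    (hT : ∀ a, T a → a ∈ l) :
    ∑ a, (if IsBest l T a then (1 : ℝ) else 0) = if ∃ a, T a then 1 else 0 := by
  split_ifs with h
  · obtain ⟨a, ha⟩ := h
    obtain ⟨b, hb, hmin⟩ := (Finset.univ.filter T).exists_min_image (fun a => l.idxOf a)
      ⟨a, by simpa using ha⟩
    have hbest : IsBest l T b := ⟨by simpa using hb, fun c hc => not_lt.2 (hmin c (by simpa using hc))⟩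
    rw [Finset.sum_eq_single b, if_pos hbest]
    · exact fun c _ hne => if_neg fun hc => hne (isBest_unique hT hc hbest)
    · exact fun h => absurd (Finset.mem_univ _) h
  · exact Finset.sum_eq_zero fun a _ => if_neg fun ha => h ⟨a, ha.1⟩

open Classical in
lemma sum_isWorst {α : Type*} [DecidableEq α] [Fintype α] {l : List α} {T : α → Prop}
    (hT : ∀ a, T a → a ∈ l) :
    ∑ a, (if IsWorst l T a then (1 : ℝ) else 0) = if ∃ a, T a then 1 else 0 := by
  split_ifs with h
  · obtain ⟨a, ha⟩ := h
    obtain ⟨b, hb, hmax⟩ := (Finset.univ.filter T).exists_max_image (fun a => l.idxOf a)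
      ⟨a, by simpa using ha⟩
    have hbest : IsWorst l T b :=
      ⟨by simpa using hb, fun c hc => not_lt.2 (hmax c (by simpa using hc))⟩
    rw [Finset.sum_eq_single b, if_pos hbest]
    · exact fun c _ hne => if_neg fun hc => hne (isWorst_unique hT hc hbest)
    · exact fun h => absurd (Finset.mem_univ _) h
  · exact Finset.sum_eq_zero fun a _ => if_neg fun ha => h ⟨a, ha.1⟩

open Classical in
/-- The logarithm of the popularity of the best stable husband of `w` minus that of the worst. -/
def logGain (p : M → PrefList W) (q : W → PrefList M) (D : W → M → ℝ) (w : W) : ℝ :=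
  (∑ m, if IsBest (q w).1 (fun m' => IsStablePair p q m' w) m then Real.log (D w m) else 0) -
    ∑ m, if IsWorst (q w).1 (fun m' => IsStablePair p q m' w) m then Real.log (D w m) else 0

open Classical in
lemma numStablePairs_eq_sum (p : M → PrefList W) (q : W → PrefList M) :
    (numStablePairs p q : ℝ) = ∑ w, ∑ m, if IsStablePair p q m w then (1 : ℝ) else 0 := by
  rw [numStablePairs, Set.ncard_eq_toFinset_card', Set.toFinset_ofPred, Finset.card_filter,
    Fintype.sum_prod_type_right]
  push_cast
  rfl

lemma numStablePairs_swap (p : M → PrefList W) (q : W → PrefList M) :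
    numStablePairs q p = numStablePairs p q := by
  classical
  have : (numStablePairs q p : ℝ) = numStablePairs p q := by
    rw [numStablePairs_eq_sum, numStablePairs_eq_sum, Finset.sum_comm]
    exact Finset.sum_congr rfl fun w _ => Finset.sum_congr rfl fun m _ =>
      if_congr (isStablePair_swap p q) rfl rfl
  exact_mod_cast this

open Classical in
/-- The expected number of stable husbands of `w`. -/
lemma profileMean_stable_husbands_le (p : M → PrefList W)
    (hD : ∀ w, ∀ m ∈ A w, 0 < D w m) (w : W) :
    profileMean A D (fun q => ∑ m, if IsStablePair p q m w then (1 : ℝ) else 0) ≤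
      profileMean A D (fun q =>
        (if ∃ m, IsStablePair p q m w
          then 1 + Real.log (min (Fintype.card M) (Fintype.card W) : ℕ) else 0) +
        logGain p q D w) := by
  -- The list of `w` is redrawn on both sides, and the inequality is proved for each fixed choice of
  -- the other lists.
  refine (profileMean_eq_update w (hD w) _).trans_le
    (le_of_le_of_eq ?_ (profileMean_eq_update w (hD w) _).symm)
  refine profileMean_mono hD fun q _ => ?_
  set S := suitorsIn p q w (A w) Set.univ with hS
  set R : M → Finset M := fun m => suitorsIn p q w (A w) {m}ᶜ with hRdef
  have hR : IsCompetition S R := isCompetition_suitorsIn p q w (A w)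
  have hSA : S ⊆ A w := fun m hm => (mem_suitorsIn.1 hm).1
  have hst : ∀ l : PrefList M, (∀ a, a ∈ l.1 ↔ a ∈ A w) → ∀ m,
      IsStablePair p (Function.update q w l) m w ↔ Wins S R l.1 m := by
    intro l hl m
    rw [isStablePair_iff_wins (A := A w) (by rwa [Function.update_self])]
    simp only [suitorsIn_update, Function.update_self]
    rfl
  have hsum : ∀ (T : M → Prop) (f : M → ℝ), (∀ m, T m → m ∈ S) →
      ∑ m, (if T m then f m else 0) = ∑ m ∈ S, if T m then f m else 0 := fun T f hT =>
    (Finset.sum_subset (Finset.subset_univ S) fun m _ hm => if_neg fun h => hm (hT m h)).symm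
  have hX : ∑ l : PrefList M, drawProb (D w) (A w) l.1 *
        (∑ m, if IsStablePair p (Function.update q w l) m w then (1 : ℝ) else 0) =
      drawMean (D w) (A w) (fun l => ∑ m ∈ S, if Wins S R l m then (1 : ℝ) else 0) := by
    refine Finset.sum_congr rfl fun l _ => ?_
    by_cases h0 : drawProb (D w) (A w) l.1 = 0
    · simp [h0]
    · congr 1
      simp only [hst l (mem_iff_of_drawProb_ne_zero h0)]
      exact hsum _ _ fun m hm => hm.1
  rw [hX]
  -- If `S` is empty, `w` has no stable husband whatever her list, and both sides vanish.
  rcases S.eq_empty_or_nonempty with hempty | hne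
  · have hno : ∀ l m, ¬ Wins S R l m := fun l m h => by simpa [hempty] using h.1
    refine le_of_eq ?_
    refine Finset.sum_congr rfl fun l _ => ?_
    by_cases h0 : drawProb (D w) (A w) l.1 = 0
    · simp [h0]
    · have hl := mem_iff_of_drawProb_ne_zero h0
      simp [logGain, hst l hl, hno, IsBest, IsWorst]
  · refine (hR.drawMean_wins_le (hD w) hSA hne (n := min (Fintype.card M) (Fintype.card W))
      fun m hm => ?_).trans (le_of_eq ?_)
    · refine card_suitors_sdiff_le (mem_suitorsIn.1 hm).2 fun a ha => ?_
      obtain ⟨h1, h2⟩ := Finset.mem_sdiff.1 ha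
      rw [mem_suitorsIn] at h1
      exact ⟨h1.2, fun h => h2 (mem_suitorsIn.2 ⟨h1.1, h⟩)⟩
    · rw [← drawMean_const (hD w) (1 + Real.log (min (Fintype.card M) (Fintype.card W) : ℕ)),
        add_sub_assoc, ← drawMean_sub, ← drawMean_add]
      refine Finset.sum_congr rfl fun l _ => ?_
      by_cases h0 : drawProb (D w) (A w) l.1 = 0
      · simp [h0]
      · have hl := mem_iff_of_drawProb_ne_zero h0
        have hlS : ∀ a ∈ S, a ∈ l.1 := fun a ha => (hl a).2 (hSA ha)
        obtain ⟨m, -, hm⟩ := exists_head?_filter_mem hne hlS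
        have hex : ∃ m, Wins S R l.1 m := ⟨m, hR.wins_of_head hm⟩
        congr 1
        simp only [logGain, hst l hl, Function.update_self]
        rw [if_pos hex, hsum _ _ fun m hm => hm.1.1, hsum _ _ fun m hm => hm.1.1,
          drawMean_const (hD w)]
        congr 2
        · exact Finset.sum_congr rfl fun m _ => by simp only [← hR.isBest_iff hlS]
        · exact Finset.sum_congr rfl fun m hm => by simp only [← hR.isWorst_iff hm]

/-- The expected number of stable pairs when the men's lists are fixed and the women have
independent popularity preferences. -/
lemma profileMean_numStablePairs_le (p : M → PrefList W)
    (hD : ∀ w, ∀ m ∈ A w, 0 < D w m) {N : ℕ} (hN : N = min (Fintype.card M) (Fintype.card W)) :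
    profileMean A D (fun q => (numStablePairs p q : ℝ)) ≤
      N * (1 + Real.log N) + profileMean A D (fun q => ∑ w, logGain p q D w) := by
  classical
  -- This includes `N = 0`, since `Real.log 0 = 0`.
  have hlog : 0 ≤ 1 + Real.log N := add_nonneg zero_le_one (Real.log_natCast_nonneg N)
  calc profileMean A D (fun q => (numStablePairs p q : ℝ))
      = ∑ w, profileMean A D (fun q => ∑ m, if IsStablePair p q m w then (1 : ℝ) else 0) := by
        rw [← profileMean_sum]
        simp only [numStablePairs_eq_sum]
    _ ≤ ∑ w, profileMean A D (fun q =>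
          (if ∃ m, IsStablePair p q m w then 1 + Real.log N else 0) + logGain p q D w) := by
        rw [hN]
        exact Finset.sum_le_sum fun w _ => profileMean_stable_husbands_le p hD w
    _ = profileMean A D (fun q => ∑ w, if ∃ m, IsStablePair p q m w then 1 + Real.log N else 0) +
          profileMean A D (fun q => ∑ w, logGain p q D w) := by
        rw [← profileMean_sum, ← profileMean_add]
        simp only [Finset.sum_add_distrib]
    _ ≤ _ := by
        refine add_le_add ?_ le_rfl
        refine (profileMean_mono hD fun q _ => ?_).trans_eq (profileMean_const hD _)
        rw [← Finset.sum_filter, Finset.sum_const, nsmul_eq_mul]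
        refine mul_le_mul_of_nonneg_right ?_ hlog
        have := ncard_women_with_stable_husband_le (p := p) (q := q)
        rw [← hN, Set.ncard_eq_toFinset_card', Set.toFinset_ofPred] at this
        exact_mod_cast this

open Classical in
/-- With intrinsic popularities, the best stable husbands are as popular as the worst ones. -/
lemma sum_logGain_eq_zero {p : M → PrefList W} {q : W → PrefList M} {D : W → M → ℝ} {d : M → ℝ}
    (h : ∀ w, ∀ m ∈ (q w).1, D w m = d m) : ∑ w, logGain p q D w = 0 := by
  have h1 : ∀ (T : M → W → Prop), (∀ m w, T m w → IsStablePair p q m w) →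
      ∑ w, ∑ m, (if T m w then Real.log (D w m) else 0) =
        ∑ m, Real.log (d m) * ∑ w, if T m w then (1 : ℝ) else 0 := by
    intro T hT
    rw [Finset.sum_comm]
    refine Finset.sum_congr rfl fun m _ => ?_
    rw [Finset.mul_sum]
    refine Finset.sum_congr rfl fun w _ => ?_
    split_ifs with hmw
    · rw [h w m (hT m w hmw).mem_woman_list, mul_one]
    · rw [mul_zero]
  simp only [logGain]
  rw [Finset.sum_sub_distrib, h1 _ fun m w h => h.1, h1 _ fun m w h => h.1, sub_eq_zero]
  refine Finset.sum_congr rfl fun m _ => ?_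
  -- Seen from `m`, both sums count one woman if he has a stable wife (his worst, respectively his
  -- best) and none otherwise.
  simp only [isBest_husband_iff_isWorst_wife, isWorst_husband_iff_isBest_wife]
  rw [sum_isBest fun w hw => IsStablePair.mem_man_list hw,
    sum_isWorst fun w hw => IsStablePair.mem_man_list hw]

/-- With symmetric popularities, the gain of the men is the loss of the women. -/
lemma sum_logGain_swap {p : M → PrefList W} {q : W → PrefList M} {DM : M → W → ℝ} {DW : W → M → ℝ}
    (h : ∀ m w, w ∈ (p m).1 → m ∈ (q w).1 → DM m w = DW w m) :
    ∑ m, logGain q p DM m = - ∑ w, logGain p q DW w := by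
  classical
  have h1 : ∀ (T : M → W → Prop), (∀ m w, T m w → IsStablePair p q m w) →
      ∑ m, ∑ w, (if T m w then Real.log (DM m w) else 0) =
        ∑ w, ∑ m, if T m w then Real.log (DW w m) else 0 := by
    intro T hT
    rw [Finset.sum_comm]
    refine Finset.sum_congr rfl fun w _ => Finset.sum_congr rfl fun m _ => ?_
    split_ifs with hmw
    · rw [h m w (hT m w hmw).mem_man_list (hT m w hmw).mem_woman_list]
    · rfl
  simp only [logGain, isStablePair_swap p q]
  -- Best husbands correspond to worst wives and conversely, so the two halves of `logGain` change
  -- places; this is the sign.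
  simp only [isBest_husband_iff_isWorst_wife, isWorst_husband_iff_isBest_wife]
  rw [Finset.sum_sub_distrib, Finset.sum_sub_distrib, neg_sub]
  congr 1
  · exact h1 _ fun m w h => h.1
  · exact h1 _ fun m w h => h.1

end ProfileMean

/-! ### From integrals to finite sums -/

section Integrals

variable {M W Ω : Type*} [Fintype M] [Fintype W] [DecidableEq M] [DecidableEq W]
  [MeasurableSpace Ω] {P : Measure Ω} [IsProbabilityMeasure P]

instance (α : Type*) : DiscreteMeasurableSpace (PrefList α) := ⟨fun _ => trivial⟩

lemma integrable_comp_and_integral_eq_sum {T : Type*} [Fintype T] [MeasurableSpace T]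
    [MeasurableSingletonClass T] {Z : Ω → T} (hZ : Measurable Z) (g : T → ℝ) :
    Integrable (fun ω => g (Z ω)) P ∧
      ∫ ω, g (Z ω) ∂P = ∑ t, P.real (Z ⁻¹' {t}) * g t := by
  have := Measure.isProbabilityMeasure_map (μ := P) hZ.aemeasurable
  have hg : Integrable g (P.map Z) := Integrable.of_finite
  refine ⟨hg.comp_measurable hZ, ?_⟩
  rw [← integral_map hZ.aemeasurable hg.aestronglyMeasurable, integral_fintype hg]
  refine Finset.sum_congr rfl fun t _ => ?_
  rw [map_measureReal_apply hZ (measurableSet_singleton t), smul_eq_mul]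

lemma measurable_profile {q : W → Ω → PrefList M} {A : W → Finset M} {D : W → M → ℝ}
    (hq : ∀ w, HasPopularityPreferences P (q w) (A w) (D w)) :
    Measurable fun ω w => q w ω :=
  measurable_pi_lambda _ fun w => (hq w).measurable

lemma measureReal_profile {q : W → Ω → PrefList M} {A : W → Finset M} {D : W → M → ℝ}
    (hq : ∀ w, HasPopularityPreferences P (q w) (A w) (D w)) (hind : iIndepFun q P)
    (l : W → PrefList M) :
    P.real ((fun ω w => q w ω) ⁻¹' {l}) = profileProb A D l := by
  have h1 : (fun ω w => q w ω) ⁻¹' {l} = ⋂ w ∈ Finset.univ, q w ⁻¹' {l w} := by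
    ext ω
    simp [funext_iff]
  have h2 := hind.measure_inter_preimage_eq_mul Finset.univ (sets := fun w => {l w})
    fun w _ => measurableSet_singleton _
  rw [Measure.real, h1, h2, ENNReal.toReal_prod]
  exact Finset.prod_congr rfl fun w _ => (hq w).law (l w)

end Integrals

end StableMarriage

end

/-! ### The two settings -/

open StableMarriage in
theorem mainTheorem4 {M W Ω : Type*} [Fintype M] [Fintype W] [DecidableEq M] [DecidableEq W]
    [MeasurableSpace Ω] (P : Measure Ω) [IsProbabilityMeasure P]
    (N : ℕ) (hN : N = min (Fintype.card M) (Fintype.card W)) :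
    -- Setting (1): arbitrary men's lists, independent popularity preferences of the women,
    -- intrinsic popularities of the men.
    (∀ (prefM : M → StableMarriage.PrefList W) (prefW : W → Ω → StableMarriage.PrefList M)
        (accW : W → Finset M) (DW : W → M → ℝ) (D : M → ℝ),
      (∀ w, StableMarriage.HasPopularityPreferences P (prefW w) (accW w) (DW w)) →
      iIndepFun prefW P →
      (∀ w, ∀ m ∈ accW w, DW w m = D m) →
      Integrable (fun ω => (StableMarriage.numStablePairs prefM (fun w => prefW w ω) : ℝ)) P ∧
      ∫ ω, (StableMarriage.numStablePairs prefM (fun w => prefW w ω) : ℝ) ∂P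
        ≤ N * (1 + Real.log N)) ∧
    -- Setting (2): independent popularity preferences of all persons, symmetric popularities.
    (∀ (prefM : M → Ω → StableMarriage.PrefList W) (prefW : W → Ω → StableMarriage.PrefList M)
        (accM : M → Finset W) (accW : W → Finset M) (DM : M → W → ℝ) (DW : W → M → ℝ),
      (∀ m, StableMarriage.HasPopularityPreferences P (prefM m) (accM m) (DM m)) →
      (∀ w, StableMarriage.HasPopularityPreferences P (prefW w) (accW w) (DW w)) →
      -- The lists of all persons are mutually independent.
      iIndepFun prefM P → iIndepFun prefW P →
      IndepFun (fun ω m => prefM m ω) (fun ω w => prefW w ω) P →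
      (∀ m w, w ∈ accM m → m ∈ accW w → DM m w = DW w m) →
      Integrable (fun ω => (StableMarriage.numStablePairs (fun m => prefM m ω)
        (fun w => prefW w ω) : ℝ)) P ∧
      ∫ ω, (StableMarriage.numStablePairs (fun m => prefM m ω) (fun w => prefW w ω) : ℝ) ∂P
        ≤ N * (1 + Real.log N)) := by
  constructor
  · intro prefM prefW accW DW D hW hWi hD
    obtain ⟨h1, h2⟩ := integrable_comp_and_integral_eq_sum (P := P) (measurable_profile hW)
      (fun q => (numStablePairs prefM q : ℝ))
    refine ⟨h1, h2.trans_le ?_⟩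
    simp only [measureReal_profile hW hWi]
    have hpos := fun w => (hW w).pos
    refine (profileMean_numStablePairs_le prefM hpos hN).trans
      ((add_le_add_right ?_ _).trans_eq (add_zero _))
    refine (profileMean_mono hpos fun q hq => ?_).trans_eq (profileMean_const hpos 0)
    exact (sum_logGain_eq_zero fun w m hm => hD w m ((hq w m).1 hm)).le
  · intro prefM prefW accM accW DM DW hM hW hMi hWi hMW hD
    obtain ⟨h1, h2⟩ := integrable_comp_and_integral_eq_sum (P := P)
      ((measurable_profile hM).prodMk (measurable_profile hW))
      (fun x => (numStablePairs x.1 x.2 : ℝ))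
    refine ⟨h1, h2.trans_le ?_⟩
    have hposM := fun m => (hM m).pos
    have hposW := fun w => (hW w).pos
    have hlaw : ∀ x : (M → PrefList W) × (W → PrefList M),
        P.real ((fun ω => ((fun m => prefM m ω), fun w => prefW w ω)) ⁻¹' {x}) =
          profileProb accM DM x.1 * profileProb accW DW x.2 := by
      rintro ⟨p, q⟩
      rw [← measureReal_profile hM hMi, ← measureReal_profile hW hWi, Measure.real, Measure.real,
        Measure.real, ← ENNReal.toReal_mul, ← hMW.measure_inter_preimage_eq_mul _ _
          (measurableSet_singleton p) (measurableSet_singleton q)]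
      congr 2
      ext ω
      simp [Prod.ext_iff]
    simp only [hlaw]
    rw [Fintype.sum_prod_type]
    set E : ((M → PrefList W) → (W → PrefList M) → ℝ) → ℝ := fun g =>
      profileMean accM DM fun p => profileMean accW DW fun q => g p q with hE
    have hEswap : ∀ g, E g =
        profileMean accW DW fun q => profileMean accM DM fun p => g p q := by
      intro g
      simp only [hE, profileMean, Finset.mul_sum]
      rw [Finset.sum_comm]
      exact Finset.sum_congr rfl fun q _ => Finset.sum_congr rfl fun p _ => mul_left_comm _ _ _
    have hgoal : ∑ p, ∑ q, profileProb accM DM p * profileProb accW DW q *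
        (numStablePairs p q : ℝ) = E fun p q => (numStablePairs p q : ℝ) := by
      simp only [hE, profileMean, Finset.mul_sum, mul_assoc]
    have hwomen : E (fun p q => (numStablePairs p q : ℝ)) ≤
        N * (1 + Real.log N) + E fun p q => ∑ w, logGain p q DW w := by
      refine (profileMean_mono hposM fun p _ =>
        profileMean_numStablePairs_le p hposW hN).trans_eq ?_
      rw [profileMean_add, profileMean_const hposM]
    -- The same bound with the sexes exchanged: the women's lists are now fixed and the men's are
    -- drawn.
    have hmen : E (fun p q => (numStablePairs p q : ℝ)) ≤
        N * (1 + Real.log N) + E fun p q => ∑ m, logGain q p DM m := by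
      rw [hEswap, hEswap]
      refine (profileMean_mono hposW fun q _ => ?_).trans_eq
        ((profileMean_add _ _).trans (congrArg (· + _) (profileMean_const hposW _)))
      simp only [← numStablePairs_swap _ q]
      exact profileMean_numStablePairs_le q hposM (hN.trans (min_comm _ _))
    -- The two error terms cancel, so half the sum of the bounds `hwomen` and `hmen` is the claim.
    have hzero : (E fun p q => ∑ w, logGain p q DW w) + (E fun p q => ∑ m, logGain q p DM m) ≤ 0 := by
      simp only [hE]
      rw [← profileMean_add]
      refine (profileMean_mono hposM fun p hp => ?_).trans_eq (profileMean_const hposM 0)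
      rw [← profileMean_add]
      refine (profileMean_mono hposW fun q hq => ?_).trans_eq (profileMean_const hposW 0)
      rw [sum_logGain_swap fun m w hw hm => hD m w ((hp m w).1 hw) ((hq w m).1 hm)]
      simp
    refine hgoal.trans_le ?_
    linarith
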